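/- **Setting.** An instance is a connected $n$-node graph $G$ whose nodes have identifiers $0,\dots,n-1$; every node knows its identifier, its neighbours, the identifier of its parent in some spanning tree of $G$ rooted at node $0$, a pattern graph $H$ with $k\ge 2$ nodes, and a natural number $\Delta$. The language $\textsc{subgraph-counting}(H)$ consists of the instances in which the number of copies of $H$ in $G$ is exactly $\Delta$ (copies may be understood as subgraphs of $G$ isomorphic to $H$, or as induced subgraphs isomorphic to $H$; the theorem holds for both). $\mathcal C[T,B]$ is the class of (randomized) distributed algorithms that run for $T$ synchronous rounds in which neighbours exchange messages of at most $B$ bits. In an $(r,\ell,\mathcal A)$-distributed interactive proof, the nodes and an unbounded randomized prover alternate for $r$ rounds, the last one being the prover's; in a prover's round the prover sends $\ell$ bits to each node, and in a verifier's round each node sends $\ell$ bits to the prover, as a function of its input, its private coins and its messages so far. Then the nodes, without the prover, run a verification algorithm from $\mathcal A$, after which each of them accepts or rejects. A language $\mathcal L$ is in $\mathrm{dStatZK}[r,\ell,\mathcal A]$ if there are such a proof system, an honest prover and a simulator $S\in\mathcal A$ such that - (completeness) on every instance in $\mathcal L$, with the honest prover, all nodes accept with probability at least $2/3$; - (soundness)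 on every instance not in $\mathcal L$ and for every prover, all nodes accept with probability at most $1/3$; - (statistical zero-knowledge) for every polynomial $p$, all sufficiently large $n$, every $n$-node instance in $\mathcal L$ and every node $v$, the output of $S$ at $v$ is within total variation distance $1/p(n)$ of the view of $v$ in the interaction with the honest prover, where the view consists of the coins of $v$, its messages to and from the prover, and all messages received from its neighbours. **Theorem.** Let $k=k(n)\ge 2$, let $H=H_n$ be a graph with $k$ nodes, and let $q=q(n)$ be primes such that either $k\in\mathcal O(1)$ and $q\in n^{\omega(1)}$, or $k\in\omega(1)$ and $q>n^k$. Then $$\textsc{subgraph-counting}(H)\in \mathrm{dStatZK}\left[\mathcal O(k\log k+\log\log n),\ \mathcal O\left(\frac{\log^2 q}{\log k}+k\log k\log q\right),\ \mathcal C\left[\mathcal O(1),\,k\cdot\mathrm{polylog}(n,k)\right]\right],$$ where the constants in the $\mathcal O$'s and in the $\mathrm{polylog}$ are absolute and the bounds hold for all sufficiently large $n$. In particular, for $k\in\mathcal O(1)$ the number of rounds is $\mathcal O(\log\log n)$. -/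

import Mathlib

open Filter

namespace DistZK

noncomputable section

/-! ### Probability over a uniform finite sample space -/

open Classical in
/-- Probability of the event `E` when `ω` is uniform on the finite set `Ω`. -/
def prob {Ω : Type} [Fintype Ω] (E : Ω → Prop) : ℝ :=
  ((Finset.univ.filter E).card : ℝ) / (Fintype.card Ω : ℝ)

/-- Total variation distance between the laws of two random variables `X`, `Y`, each defined on
its own uniform finite sample space: the supremum over all events `A` of the difference of the
probabilities of `A`. -/
def tvDist {Ω Ω' α : Type} [Fintype Ω] [Fintype Ω'] (X : Ω → α) (Y : Ω' → α) : ℝ :=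
  ⨆ A : Set α, |prob (fun ω => X ω ∈ A) - prob (fun ω => Y ω ∈ A)|

/-- A message of `b` bits. -/
abbrev Bits (b : ℕ) : Type := Fin b → Bool

/-! ### Networks and inputs -/

/-- An `n`-node network with its inputs. The vertex `v : Fin n` is the node with identifier `v`.
Every node is given its own identifier, the identifier of its parent in a spanning tree rooted at
the node with identifier `0` (the root is, by convention, its own parent), and the number
`target`. -/
structure Instance (n : ℕ) where
  graph : SimpleGraph (Fin n)
  connected : graph.Connected
  parent : Fin n → Fin n
  parent_root : ∀ v : Fin n, v.val = 0 → parent v = v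
  parent_adj : ∀ v : Fin n, v.val ≠ 0 → graph.Adj v (parent v)
  parent_reaches_root : ∀ v : Fin n, ∃ m : ℕ, (parent^[m] v).val = 0
  target : ℕ

/-- What a node knows before any communication: its identifier, the identifiers of its neighbours,
the identifier of its parent, and the number `target`. -/
structure LocalInput (n : ℕ) where
  id : Fin n
  nbrs : Set (Fin n)
  parent : Fin n
  target : ℕ

/-- The local input of the node `v`. -/
def Instance.localInput {n : ℕ} (I : Instance n) (v : Fin n) : LocalInput n where
  id := v
  nbrs := I.graph.neighborSet v
  parent := I.parent v
  target := I.target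

/-- A distributed language: for every number `n` of nodes, a set of `n`-node instances. -/
abbrev Language : Type := ∀ n : ℕ, Set (Instance n)

/-! ### Distributed algorithms -/

/-- What a node receives from its neighbours: for each elapsed round, the `B`-bit message that came
from each neighbour (`none` for nodes that are not neighbours). -/
abbrev Inbox (n B : ℕ) : Type := List (Fin n → Option (Bits B))

/-- A distributed algorithm with `T` synchronous rounds and `B`-bit messages on every edge and in
each direction per round. A node with local data `x : In` and messages `m` received so far sends
`send x m u` to its neighbour `u`; after round `T` it outputs `output x m`. Randomness, where it is
used, is part of the local data. -/
structure DistAlg (n T B : ℕ) (In Out : Type) where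
  send : In → Inbox n B → Fin n → Bits B
  output : In → Inbox n B → Out

namespace DistAlg

variable {n T B : ℕ} {In Out : Type}

open Classical in
/-- The messages received by each node in the first `t` rounds on the graph `G`. -/
def inbox (A : DistAlg n T B In Out) (G : SimpleGraph (Fin n)) (x : Fin n → In) :
    ℕ → Fin n → Inbox n B
  | 0 => fun _ => []
  | t + 1 => fun v =>
      A.inbox G x t v ++
        [fun u => if G.Adj u v then some (A.send (x u) (A.inbox G x t u) v) else none]

/-- The output of the node `v` after all `T` rounds. -/
def run (A : DistAlg n T B In Out) (G : SimpleGraph (Fin n)) (x : Fin n → In) (v : Fin n) : Out :=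
  A.output (x v) (A.inbox G x T v)

end DistAlg

/-! ### Distributed interactive proofs -/

/-- The verifier of a distributed interactive proof with `r` rounds of interaction and `l`-bit
messages, whose verification algorithm has `T` rounds and `B`-bit messages. Every node has private
random coins, uniform on the finite set `Coin` and independent of those of the other nodes.
In a verifier's round, a node sends to the prover a message that depends on its local input, its
coins, and the messages that it has exchanged with the prover so far (`respond`). After the
interaction the nodes run `verify`, where the local data of a node are its local input, its coins
and all its messages to and from the prover; the output `true` means `accept`. -/
structure Verifier (n r l T B : ℕ) where
  Coin : Type
  [coinFintype : Fintype Coin]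
  [coinNonempty : Nonempty Coin]
  respond : LocalInput n → Coin → List (Bits l) → Bits l
  verify : DistAlg n T B (LocalInput n × Coin × List (Bits l)) Bool

attribute [instance] Verifier.coinFintype Verifier.coinNonempty

/-- A prover, computationally unbounded and randomized. In a prover's round it sends an `l`-bit
message to each node, depending on its own coins and on all messages exchanged so far between it
and all the nodes. -/
structure Prover (n l : ℕ) where
  Coin : Type
  [coinFintype : Fintype Coin]
  [coinNonempty : Nonempty Coin]
  next : Coin → List (Fin n → Bits l) → Fin n → Bits l

attribute [instance] Prover.coinFintype Prover.coinNonempty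

/-- The view of a node: its private coins, all messages that it exchanged with the prover, and all
messages that it received from its neighbours during the verification algorithm. -/
structure View (n l B : ℕ) (Coin : Type) where
  coin : Coin
  interaction : List (Bits l)
  inbox : Inbox n B

namespace Verifier

variable {n r l T B : ℕ}

/-- The sample space of an execution: the coins of all nodes and those of the prover. -/
abbrev Sample (V : Verifier n r l T B) (P : Prover n l) : Type := (Fin n → V.Coin) × P.Coin

open Classical in
/-- The messages of the first `i` rounds of interaction, oldest first; the entry of a round gives,
for each node, the message sent by or to that node. The two sides alternate so that round `r`, the
last one, is a prover's round. -/
def interact (V : Verifier n r l T B) (P : Prover n l) (I : Instance n) (ω : V.Sample P) :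
    ℕ → List (Fin n → Bits l)
  | 0 => []
  | i + 1 =>
      V.interact P I ω i ++
        [if Odd (r - i) then P.next ω.2 (V.interact P I ω i)
         else fun v => V.respond (I.localInput v) (ω.1 v) ((V.interact P I ω i).map fun m => m v)]

/-- The messages exchanged between the prover and the node `v` in all `r` rounds. -/
def nodeInteraction (V : Verifier n r l T B) (P : Prover n l) (I : Instance n) (ω : V.Sample P)
    (v : Fin n) : List (Bits l) :=
  (V.interact P I ω r).map fun m => m v

/-- The local data of the node `v` at the start of the verification algorithm. -/
def verifyInput (V : Verifier n r l T B) (P : Prover n l) (I : Instance n) (ω : V.Sample P)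
    (v : Fin n) : LocalInput n × V.Coin × List (Bits l) :=
  (I.localInput v, ω.1 v, V.nodeInteraction P I ω v)

/-- The probability that all nodes accept. -/
def acceptProb (V : Verifier n r l T B) (P : Prover n l) (I : Instance n) : ℝ :=
  prob fun ω : V.Sample P =>
    ∀ v : Fin n, V.verify.run I.graph (V.verifyInput P I ω) v = true

/-- The view of the node `v`, as a random variable. -/
def view (V : Verifier n r l T B) (P : Prover n l) (I : Instance n) (v : Fin n)
    (ω : V.Sample P) : View n l B V.Coin where
  coin := ω.1 v
  interaction := V.nodeInteraction P I ω v
  inbox := V.verify.inbox I.graph (V.verifyInput P I ω) T v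

end Verifier

/-- A simulator: a randomized distributed algorithm, without any prover, with `T` rounds and `B`-bit
messages. -/
structure Simulator (n T B : ℕ) (Out : Type) where
  Coin : Type
  [coinFintype : Fintype Coin]
  [coinNonempty : Nonempty Coin]
  alg : DistAlg n T B (LocalInput n × Coin) Out

attribute [instance] Simulator.coinFintype Simulator.coinNonempty

/-- The output of the simulator at the node `v`, as a random variable. -/
def Simulator.out {n T B : ℕ} {Out : Type} (S : Simulator n T B Out) (I : Instance n) (v : Fin n)
    (ω : Fin n → S.Coin) : Out :=
  S.alg.run I.graph (fun u => (I.localInput u, ω u)) v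

/-- The class of languages with a distributed statistical zero-knowledge proof with `r n` rounds of
interaction, `l n`-bit messages, and with verification algorithm and simulator both having `T`
rounds and `B n`-bit messages, on `n`-node networks.
The honest prover is the one of the completeness condition, and zero-knowledge is required on the
instances in the language: the total variation distance between the simulated and the real view
of each node is eventually below every inverse power of `n`. -/
def DStatZK (r l : ℕ → ℕ) (T : ℕ) (B : ℕ → ℕ) : Set Language :=
  {L | ∃ (V : ∀ n, Verifier n (r n) (l n) T (B n))
      (P : ∀ n, Instance n → Prover n (l n))
      (S : ∀ n, Simulator n T (B n) (View n (l n) (B n) (V n).Coin)),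
      -- completeness
      (∀ n, ∀ I ∈ L n, 2 / 3 ≤ (V n).acceptProb (P n I) I) ∧
      -- soundness
      (∀ n, ∀ I ∉ L n, ∀ P' : Prover n (l n), (V n).acceptProb P' I ≤ 1 / 3) ∧
      -- statistical zero-knowledge
      (∀ c : ℕ, ∀ᶠ n : ℕ in atTop, ∀ I ∈ L n, ∀ v : Fin n,
        tvDist ((S n).out I v) ((V n).view (P n I) I v) ≤ 1 / (n : ℝ) ^ c)}

/-! ### Subgraph counting -/

/-- Which copies of the pattern are counted. -/
inductive CopyKind
  | subgraph
  | inducedSubgraph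

/-- The number of copies of `H` in `G`: of subgraphs of `G` isomorphic to `H`, or of vertex sets on
which `G` induces a graph isomorphic to `H`. -/
def numCopies {n k : ℕ} (κ : CopyKind) (H : SimpleGraph (Fin k)) (G : SimpleGraph (Fin n)) : ℕ :=
  match κ with
  | .subgraph => G.copyCount H
  | .inducedSubgraph => Nat.card {s : Set (Fin n) // Nonempty (H ≃g G.induce s)}

/-- The language of the instances in which the number of copies of the pattern (on networks with `n`
nodes, the `k n`-node graph `H n`) is exactly the number `target` given to the nodes. -/
def subgraphCounting (κ : CopyKind) (k : ℕ → ℕ) (H : ∀ n, SimpleGraph (Fin (k n))) : Language :=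
  fun n => {I | numCopies κ (H n) I.graph = I.target}

end

end DistZK

namespace DistZK

/-! ### Labelled and unlabelled copies -/

/-! The maps that place `H` onto a copy in `G` number `|Aut H|` times the copies
(`card_isLabelledCopy`). This number is a sum over all `w : Fin k → Fin n` of a product over pairs
`a < b` of 0/1 entries, each known to the node `w b`. Interpolating the entries in both variables
makes the count the sum of a polynomial over a grid, and the sum-check protocol applies, over a
prime field with more than `n ^ k` elements, so that equality in the field is equality of numbers.

The verifier is distributed by sharing the coefficients of the sum-check polynomials additively
among the nodes. Each check then says that locally computable contributions of the nodes add up to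
zero. A last challenge merges all checks into one, which is summed along the spanning tree. Only the
root's coins matter: neighbours compare the last challenge and a fingerprint of the others, and
connectivity does the rest. If a wrong instance is accepted, then some nonzero polynomial, fixed
before a challenge, vanishes at it (`AllAccept.bad`); counting roots and a union bound give
`protocol_sound`.

Zero knowledge is perfect for `n ≥ 2`. The two shares of a coefficient go to different nodes. The
interpolated entries are masked by multiples of a polynomial that vanishes at the nodes, which
leaves the count unchanged but makes the entries revealed at the challenges, which avoid the nodes,
uniform. The subtree sums carry masks too. For fixed verifier coins, what a node sees is part of a
bijective image of the prover's coins (`revealed_injective`), so independent uniform values simulate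
it exactly.

The prime has `O(k log n)` bits, there are `2k + 1` challenges, and a message holds `O(k)` field
elements; since `n ^ k < q`, this fits the claimed bounds. -/

theorem card_eq_card_mul_of_fibers {X Y : Type*} [Finite X] [Finite Y] (f : X → Y) (m : ℕ)
    (h : ∀ y, Nat.card {x // f x = y} = m) : Nat.card X = m * Nat.card Y := by
  have := Fintype.ofFinite Y
  rw [← Nat.card_congr (Equiv.sigmaFiberEquiv f), Nat.card_sigma]
  simp [h, mul_comm]

theorem card_iso_eq {V W : Type*} {H : SimpleGraph V} {G : SimpleGraph W} (e : H ≃g G) :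
    Nat.card (H ≃g G) = Nat.card (H ≃g H) :=
  Nat.card_congr
    { toFun := fun g => g.trans e.symm
      invFun := fun g => g.trans e
      left_inv := fun g => by ext; simp
      right_inv := fun g => by ext; simp }

/-- A copy amounts to its image together with an isomorphism from `H` onto it, and the isomorphisms
onto a fixed image form a torsor under `Aut H`. The induced case below runs the same way, with the
range in place of the subgraph. -/
theorem card_copy {V W : Type*} [Finite V] [Finite W] (H : SimpleGraph V) (G : SimpleGraph W) :
    Nat.card (SimpleGraph.Copy H G) =
      Nat.card (H ≃g H) * Nat.card {S : G.Subgraph // Nonempty (H ≃g S.coe)} := by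
  have : Finite (SimpleGraph.Copy H G) := DFunLike.finite _
  refine card_eq_card_mul_of_fibers
    (fun f : SimpleGraph.Copy H G =>
      (⟨f.toSubgraph, ⟨f.isoToSubgraph⟩⟩ : {S : G.Subgraph // Nonempty (H ≃g S.coe)})) _ ?_
  rintro ⟨S, ⟨e⟩⟩
  rw [← card_iso_eq e]
  symm
  have key : ∀ e' : H ≃g S.coe,
      (⟨S.hom.comp e'.toHom, SimpleGraph.Subgraph.hom_injective.comp e'.injective⟩ :
        SimpleGraph.Copy H G).toSubgraph = S := by
    intro e'
    simp [SimpleGraph.Copy.toSubgraph, SimpleGraph.Subgraph.map_comp]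
  refine Nat.card_congr (Equiv.ofBijective (fun e' => ⟨_, Subtype.ext (key e')⟩) ⟨?_, ?_⟩)
  · intro e₁ e₂ h
    ext x
    exact congrArg (fun c : SimpleGraph.Copy H G => c x) (congrArg Subtype.val h)
  · rintro ⟨f, hf⟩
    have hf' : f.toSubgraph = S := congrArg Subtype.val hf
    subst hf'
    refine ⟨f.isoToSubgraph, ?_⟩
    apply Subtype.ext
    ext x
    rfl

theorem card_embedding {V W : Type*} [Finite V] [Finite W] (H : SimpleGraph V)
    (G : SimpleGraph W) :
    Nat.card (H ↪g G) =
      Nat.card (H ≃g H) * Nat.card {s : Set W // Nonempty (H ≃g G.induce s)} := by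
  have : Finite (H ↪g G) := DFunLike.finite _
  refine card_eq_card_mul_of_fibers
    (fun f : H ↪g G =>
      (⟨Set.range f, ⟨f.isoInduceRange⟩⟩ : {s : Set W // Nonempty (H ≃g G.induce s)})) _ ?_
  rintro ⟨s, ⟨e⟩⟩
  rw [← card_iso_eq e]
  symm
  have key : ∀ e' : H ≃g G.induce s,
      Set.range ((SimpleGraph.Embedding.induce s).comp e'.toEmbedding : H ↪g G) = s := by
    intro e'
    ext x
    constructor
    · rintro ⟨y, rfl⟩
      exact (e' y).2
    · intro hx
      exact ⟨e'.symm ⟨x, hx⟩, by simp⟩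
  refine Nat.card_congr (Equiv.ofBijective (fun e' => ⟨_, Subtype.ext (key e')⟩) ⟨?_, ?_⟩)
  · intro e₁ e₂ h
    ext x
    have := congrArg (fun c : H ↪g G => c x) (congrArg Subtype.val h)
    simpa using this
  · rintro ⟨f, hf⟩
    have hf' : Set.range f = s := congrArg Subtype.val hf
    subst hf'
    refine ⟨f.isoInduceRange, ?_⟩
    apply Subtype.ext
    ext x
    rfl

/-- The condition that a pair `a`, `b` of pattern vertices puts on the adjacency of their images. -/
def PairOk {k : ℕ} (κ : CopyKind) (H : SimpleGraph (Fin k)) (a b : Fin k) (adj : Prop) : Prop :=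
  (H.Adj a b → adj) ∧ (κ = .inducedSubgraph → adj → H.Adj a b)

/-- `w` maps the pattern injectively onto a copy of it in `G`. -/
def IsLabelledCopy {n k : ℕ} (κ : CopyKind) (H : SimpleGraph (Fin k)) (G : SimpleGraph (Fin n))
    (w : Fin k → Fin n) : Prop :=
  ∀ a b, a < b → w a ≠ w b ∧ PairOk κ H a b (G.Adj (w a) (w b))

theorem IsLabelledCopy.injective {n k : ℕ} {κ : CopyKind} {H : SimpleGraph (Fin k)}
    {G : SimpleGraph (Fin n)} {w : Fin k → Fin n} (h : IsLabelledCopy κ H G w) :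
    Function.Injective w := by
  intro a b hab
  by_contra hne
  rcases lt_or_gt_of_ne hne with hlt | hlt
  · exact (h a b hlt).1 hab
  · exact (h b a hlt).1 hab.symm

theorem IsLabelledCopy.pairOk {n k : ℕ} {κ : CopyKind} {H : SimpleGraph (Fin k)}
    {G : SimpleGraph (Fin n)} {w : Fin k → Fin n} (h : IsLabelledCopy κ H G w) (a b : Fin k) :
    PairOk κ H a b (G.Adj (w a) (w b)) := by
  rcases lt_trichotomy a b with hlt | rfl | hlt
  · exact (h a b hlt).2
  · exact ⟨fun h => (H.irrefl h).elim, fun _ h => (G.irrefl h).elim⟩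
  · have := (h b a hlt).2
    exact ⟨fun h => (this.1 h.symm).symm, fun h₁ h₂ => (this.2 h₁ h₂.symm).symm⟩

theorem card_isLabelledCopy {n k : ℕ} (κ : CopyKind) (H : SimpleGraph (Fin k))
    (G : SimpleGraph (Fin n)) :
    Nat.card {w : Fin k → Fin n // IsLabelledCopy κ H G w} =
      Nat.card (H ≃g H) * numCopies κ H G := by
  cases κ with
  | subgraph =>
    have hc : numCopies .subgraph H G = Nat.card {S : G.Subgraph // Nonempty (H ≃g S.coe)} := by
      simp only [numCopies, SimpleGraph.copyCount]
      exact (Nat.subtype_card _ (by simp)).symm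
    rw [hc, ← card_copy]
    refine Nat.card_congr
      { toFun := fun w => ⟨⟨w.1, fun {a b} h => (w.2.pairOk a b).1 h⟩, w.2.injective⟩
        invFun := fun f => ⟨f, fun a b hab => ⟨fun h => hab.ne (f.injective h),
          fun h => f.toHom.map_adj h, fun h => by cases h⟩⟩
        left_inv := fun w => rfl
        right_inv := fun f => rfl }
  | inducedSubgraph =>
    change _ = _ * Nat.card {s : Set (Fin n) // Nonempty (H ≃g G.induce s)}
    rw [← card_embedding]
    refine Nat.card_congr
      { toFun := fun w => ⟨⟨w.1, w.2.injective⟩, fun {a b} =>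
          ⟨(w.2.pairOk a b).2 rfl, (w.2.pairOk a b).1⟩⟩
        invFun := fun f => ⟨f, fun a b hab => ⟨fun h => hab.ne (f.injective h),
          fun h => f.map_adj_iff.2 h, fun _ h => f.map_adj_iff.1 h⟩⟩
        left_inv := fun w => rfl
        right_inv := fun f => rfl }

end DistZK

namespace DistZK

/-! ### Uniform probability -/

open Function

/-- Exchanging `w i` with the fresh value `v` is an involution on the pairs `(w, v)`. This one fact
serves both for resampling a single coin and for freeing a variable in the sum-check. -/
theorem sum_sum_update {ι α β : Type*} [Fintype ι] [DecidableEq ι] [Fintype α]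
    [AddCommMonoid β] (g : (ι → α) → β) (i : ι) :
    ∑ w, ∑ v, g (update w i v) = Fintype.card α • ∑ w, g w := by
  have h : ∑ x : (ι → α) × α, g (update x.1 i x.2) = ∑ x : (ι → α) × α, g x.1 := by
    refine Fintype.sum_equiv
      { toFun := fun x => (update x.1 i x.2, x.1 i)
        invFun := fun x => (update x.1 i x.2, x.1 i)
        left_inv := fun x => by simp
        right_inv := fun x => by simp } _ _ fun x => rfl
  rw [← Fintype.sum_prod_type', h, Fintype.sum_prod_type]
  simp [Finset.smul_sum]

open Classical in
theorem prob_eq_sum {Ω : Type} [Fintype Ω] (E : Ω → Prop) :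
    prob E = (∑ ω, if E ω then (1 : ℝ) else 0) / Fintype.card Ω := by
  simp [prob]

theorem prob_mono {Ω : Type} [Fintype Ω] {E E' : Ω → Prop} (h : ∀ ω, E ω → E' ω) :
    prob E ≤ prob E' := by
  unfold prob
  gcongr with ω
  exact h ω

theorem prob_of_forall {Ω : Type} [Fintype Ω] [Nonempty Ω] {E : Ω → Prop} (h : ∀ ω, E ω) :
    prob E = 1 := by
  have : (Fintype.card Ω : ℝ) ≠ 0 := by simp
  simp [prob, h, this]

theorem prob_eq_avg_update {ι α : Type} [Fintype ι] [DecidableEq ι] [Fintype α] [Nonempty α]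
    (E : (ι → α) → Prop) (i : ι) :
    prob E = (∑ w, prob fun v => E (update w i v)) / Fintype.card (ι → α) := by
  classical
  have hα : (Fintype.card α : ℝ) ≠ 0 := by simp
  have h := sum_sum_update (fun w => if E w then (1 : ℝ) else 0) i
  simp only [prob_eq_sum, ← Finset.sum_div, h, nsmul_eq_mul]
  congr 1
  field_simp

theorem prob_le_of_update {ι α : Type} [Fintype ι] [DecidableEq ι] [Fintype α] [Nonempty α]
    (E : (ι → α) → Prop) (i : ι) {δ : ℝ} (h : ∀ w, prob (fun v => E (update w i v)) ≤ δ) :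
    prob E ≤ δ := by
  rw [prob_eq_avg_update E i]
  have hc : (0 : ℝ) < Fintype.card (ι → α) := by exact_mod_cast Fintype.card_pos
  rw [div_le_iff₀ hc]
  refine (Finset.sum_le_sum fun w _ => h w).trans ?_
  simp [mul_comm]

theorem prob_comp_eval {ι α : Type} [Fintype ι] [DecidableEq ι] [Fintype α] [Nonempty α]
    (E : α → Prop) (i : ι) : prob (fun w : ι → α => E (w i)) = prob E := by
  rw [prob_eq_avg_update _ i]
  have hc : (Fintype.card (ι → α) : ℝ) ≠ 0 := by simp
  simp only [update_self, Finset.sum_const, Finset.card_univ, nsmul_eq_mul]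
  field_simp

theorem prob_comp_bijective {Ω : Type} [Fintype Ω] (E : Ω → Prop) {Φ : Ω → Ω}
    (hΦ : Bijective Φ) : prob (fun ω => E (Φ ω)) = prob E := by
  classical
  rw [prob_eq_sum, prob_eq_sum]
  congr 1
  exact Fintype.sum_bijective Φ hΦ _ _ fun _ => rfl

theorem prob_prod_le {A B : Type} [Fintype A] [Fintype B] [Nonempty A] [Nonempty B]
    (E : A × B → Prop) {δ : ℝ} (h : ∀ b, prob (fun a => E (a, b)) ≤ δ) : prob E ≤ δ := by
  classical
  have hA : (0 : ℝ) < Fintype.card A := by exact_mod_cast Fintype.card_pos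
  have hB : (0 : ℝ) < Fintype.card B := by exact_mod_cast Fintype.card_pos
  simp only [prob_eq_sum, div_le_iff₀ hA] at h
  rw [prob_eq_sum, Fintype.card_prod, Nat.cast_mul, div_le_iff₀ (by positivity),
    Fintype.sum_prod_type_right]
  refine (Finset.sum_le_sum fun b _ => h b).trans ?_
  rw [Finset.sum_const, Finset.card_univ, nsmul_eq_mul]
  exact le_of_eq (by ring)

theorem prob_exists_le {ι Ω : Type} [Fintype ι] [Fintype Ω] (E : ι → Ω → Prop) :
    prob (fun ω => ∃ i, E i ω) ≤ ∑ i, prob (E i) := by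
  classical
  simp only [prob_eq_sum, ← Finset.sum_div]
  gcongr
  rw [Finset.sum_comm]
  refine Finset.sum_le_sum fun ω _ => ?_
  split_ifs with h
  · obtain ⟨i, hi⟩ := h
    refine le_trans (by simp [hi]) (Finset.single_le_sum
      (f := fun i => if E i ω then (1 : ℝ) else 0) (fun j _ => ?_) (Finset.mem_univ i))
    split_ifs <;> norm_num
  · exact Finset.sum_nonneg fun j _ => by split_ifs <;> norm_num

/-- Union bound for events that are unlikely over one coordinate when the others are fixed. -/
theorem prob_exists_le_of_update {ι α : Type} [Fintype ι] [DecidableEq ι] [Fintype α] [Nonempty α]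
    (E : ι → (ι → α) → Prop) {δ : ℝ}
    (h : ∀ i w, prob (fun v => E i (update w i v)) ≤ δ) :
    prob (fun w => ∃ i, E i w) ≤ Fintype.card ι * δ := by
  refine (prob_exists_le E).trans ?_
  refine (Finset.sum_le_sum fun i _ => prob_le_of_update (E i) i (h i)).trans ?_
  simp

/-! ### Public-coin protocols with typed messages -/

/-- The verifier of a public-coin protocol with `K` challenges in `R`, prover messages in `M`, and
one round of verification with messages in `E`. Prover messages are indexed by their time. -/
structure PublicCoin (n K : ℕ) (R M E : Type) where
  send : LocalInput n → (Fin K → R) → (ℕ → M) → Fin n → E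
  accept : LocalInput n → (Fin K → R) → (ℕ → M) → (Fin n → Option E) → Prop

/-- Binary encodings of the messages of a public-coin protocol. -/
structure Encodings (l B : ℕ) (R M E : Type) where
  challenge : R ↪ Bits l
  message : M ↪ Bits l
  edge : E ↪ Bits B

namespace PublicCoin

variable {n K l B : ℕ} {R M E : Type}

/-- The prover that follows the strategy `W`, for the coins of the node `root`. -/
noncomputable abbrev honest {PC : Type} [Fintype PC] [Nonempty PC] [Nonempty R]
    (ℰ : Encodings l B R M E) (root : Fin n) (W : PC → (Fin K → R) → ℕ → Fin n → M) :
    Prover n l where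
  Coin := PC
  -- Prover messages occupy the even positions, so challenge `j` stands at position `2 * j + 1` and
  -- the current time is `h.length / 2`. The challenges of the other nodes are ignored.
  next pc h v := ℰ.message (W pc
    (fun j => invFun ℰ.challenge ((h.getD (2 * j.val + 1) default) root)) (h.length / 2) v)

theorem honest_next {PC : Type} [Fintype PC] [Nonempty PC] [Nonempty R] (ℰ : Encodings l B R M E)
    (root : Fin n) (W : PC → (Fin K → R) → ℕ → Fin n → M) (pc : PC) (h : List (Fin n → Bits l))
    (v : Fin n) : (honest ℰ root W).next pc h v = ℰ.message (W pc
      (fun j => invFun ℰ.challenge ((h.getD (2 * j.val + 1) default) root)) (h.length / 2) v) := rfl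

variable [Fintype R] [Nonempty R] [Nonempty M] [Nonempty E]

/-- The prover messages contained in a transcript that starts with a prover message. -/
noncomputable def decode (ℰ : Encodings l B R M E) (h : List (Bits l)) (t : ℕ) : M :=
  invFun ℰ.message (h.getD (2 * t) default)

open Classical in
/-- The verifier with binary messages. -/
noncomputable abbrev verifier (Q : PublicCoin n K R M E) (ℰ : Encodings l B R M E) :
    Verifier n (2 * K + 1) l 1 B where
  Coin := Fin K → R
  respond _ c h := if hh : h.length / 2 < K then ℰ.challenge (c ⟨_, hh⟩) else default
  verify :=
    { send := fun x _ u => ℰ.edge (Q.send x.1 x.2.1 (decode ℰ x.2.2) u)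
      output := fun x m => decide (Q.accept x.1 x.2.1 (decode ℰ x.2.2)
        fun u => ((m.headD fun _ => none) u).map (invFun ℰ.edge)) }

theorem respond_eq (Q : PublicCoin n K R M E) (ℰ : Encodings l B R M E) (li : LocalInput n)
    (c : Fin K → R) (h : List (Bits l)) : (Q.verifier ℰ).respond li c h =
      if hh : h.length / 2 < K then ℰ.challenge (c ⟨_, hh⟩) else default := rfl

/-- The message of round `j`. -/
noncomputable def roundMsg {r T : ℕ} (V : Verifier n r l T B) (P : Prover n l) (I : Instance n)
    (ω : V.Sample P) (j : ℕ) : Fin n → Bits l :=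
  open Classical in
  if Odd (r - j) then P.next ω.2 (V.interact P I ω j)
  else fun v => V.respond (I.localInput v) (ω.1 v) ((V.interact P I ω j).map fun m => m v)

theorem interact_eq {r T : ℕ} (V : Verifier n r l T B) (P : Prover n l) (I : Instance n)
    (ω : V.Sample P) (i : ℕ) :
    V.interact P I ω i = (List.range i).map (roundMsg V P I ω) := by
  induction i with
  | zero => rfl
  | succ i ih =>
    rw [List.range_succ, List.map_append, ← ih]
    rfl

theorem interact_length {r T : ℕ} (V : Verifier n r l T B) (P : Prover n l) (I : Instance n)
    (ω : V.Sample P) (i : ℕ) : (V.interact P I ω i).length = i := by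
  simp [interact_eq]

section Rounds

variable (Q : PublicCoin n K R M E) (ℰ : Encodings l B R M E) (P : Prover n l) (I : Instance n)

theorem roundMsg_even (ω : (Q.verifier ℰ).Sample P) {t : ℕ} (ht : t ≤ K) :
    roundMsg (Q.verifier ℰ) P I ω (2 * t) =
      P.next ω.2 ((Q.verifier ℰ).interact P I ω (2 * t)) := by
  have : Odd (2 * K + 1 - 2 * t) := ⟨K - t, by omega⟩
  simp [roundMsg, this]

theorem roundMsg_odd (ω : (Q.verifier ℰ).Sample P) {t : ℕ} (ht : t < K) (v : Fin n) :
    roundMsg (Q.verifier ℰ) P I ω (2 * t + 1) v = ℰ.challenge (ω.1 v ⟨t, ht⟩) := by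
  have : ¬ Odd (2 * K + 1 - (2 * t + 1)) := by
    rw [Nat.not_odd_iff_even]
    exact ⟨K - t, by omega⟩
  have h2 : (2 * t + 1) / 2 = t := by omega
  rw [roundMsg, if_neg this, respond_eq, dif_pos] <;>
    simp only [List.length_map, interact_length, h2, ht]

/-- The prover's messages in an execution. -/
noncomputable def proverMsg (ω : (Q.verifier ℰ).Sample P) (t : ℕ) (v : Fin n) : M :=
  decode ℰ ((Q.verifier ℰ).nodeInteraction P I ω v) t

theorem proverMsg_eq (ω : (Q.verifier ℰ).Sample P) {t : ℕ} (ht : t ≤ K) (v : Fin n) :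
    proverMsg Q ℰ P I ω t v =
      invFun ℰ.message (roundMsg (Q.verifier ℰ) P I ω (2 * t) v) := by
  have : 2 * t < 2 * K + 1 := by omega
  simp [proverMsg, decode, Verifier.nodeInteraction, interact_eq, List.getD, this]

theorem proverMsg_of_gt (ω : (Q.verifier ℰ).Sample P) {t : ℕ} (ht : K < t) (v : Fin n) :
    proverMsg Q ℰ P I ω t v = invFun ℰ.message default := by
  have : ¬ 2 * t < 2 * K + 1 := by omega
  simp [proverMsg, decode, Verifier.nodeInteraction, interact_eq, List.getD, this]

open Classical in
/-- What node `v` receives from its neighbours. -/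
noncomputable def received (x : Fin n → LocalInput n × (Fin K → R) × (ℕ → M)) (v u : Fin n) :
    Option E :=
  if I.graph.Adj u v then some (Q.send (x u).1 (x u).2.1 (x u).2.2 v) else none

open Classical in
theorem view_inbox (ω : (Q.verifier ℰ).Sample P) (v : Fin n) :
    ((Q.verifier ℰ).view P I v ω).inbox =
      [fun u => if I.graph.Adj u v then some (ℰ.edge (Q.send (I.localInput u) (ω.1 u)
        (fun t => proverMsg Q ℰ P I ω t u) v)) else none] := rfl

theorem run_iff (ω : (Q.verifier ℰ).Sample P) (v : Fin n) :
    (Q.verifier ℰ).verify.run I.graph ((Q.verifier ℰ).verifyInput P I ω) v = true ↔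
      Q.accept (I.localInput v) (ω.1 v) (fun t => proverMsg Q ℰ P I ω t v)
        (Q.received I (fun u => (I.localInput u, ω.1 u, fun t => proverMsg Q ℰ P I ω t u)) v) := by
  have : (fun u => ((((Q.verifier ℰ).view P I v ω).inbox.headD fun _ => none) u).map
      (invFun ℰ.edge)) =
      Q.received I (fun u => (I.localInput u, ω.1 u, fun t => proverMsg Q ℰ P I ω t u)) v := by
    funext u
    rw [view_inbox]
    by_cases h : I.graph.Adj u v
    · simp [received, h, leftInverse_invFun ℰ.edge.injective _]
    · simp [received, h]
  rw [← this]
  simp only [DistAlg.run, verifier, decide_eq_true_eq]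
  rfl

end Rounds

/-- A strategy chooses the message at time `t` as a function of the challenges before `t`. -/
def NonAnticipating {α : Type} (W : (Fin K → R) → ℕ → α) : Prop :=
  ∀ c c' t, (∀ j : Fin K, j.val < t → c j = c' j) → W c t = W c' t

/-- All nodes accept when the node `v` has coins `coins v` and the prover's messages are `w`. -/
def AllAccept (Q : PublicCoin n K R M E) (I : Instance n) (coins : Fin n → Fin K → R)
    (w : ℕ → Fin n → M) : Prop :=
  ∀ v, Q.accept (I.localInput v) (coins v) (fun t => w t v)
    (Q.received I (fun u => (I.localInput u, coins u, fun t => w t u)) v)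

/-- Causality: challenge `j` is sent in round `2 * j + 1`, so it cannot influence a shorter
transcript. -/
theorem interact_congr (Q : PublicCoin n K R M E) (ℰ : Encodings l B R M E) (P : Prover n l)
    (I : Instance n) (o o' : Fin n → Fin K → R) (pc : P.Coin) (i : ℕ)
    (h : ∀ v, ∀ j : Fin K, 2 * j.val + 1 < i → o v j = o' v j) :
    (Q.verifier ℰ).interact P I (o, pc) i = (Q.verifier ℰ).interact P I (o', pc) i := by
  induction i with
  | zero => rfl
  | succ i ih =>
    have ih' := ih fun v j hj => h v j (by omega)
    rw [interact_eq, interact_eq, List.range_succ, List.map_append, List.map_append,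
      ← interact_eq, ← interact_eq, ih']
    congr 1
    simp only [List.map_cons, List.map_nil, List.cons.injEq, and_true]
    by_cases hodd : Odd (2 * K + 1 - i)
    · simp [roundMsg, hodd, ih']
    · simp only [roundMsg, hodd, if_false, ih']
      funext v
      simp only [verifier, List.length_map, interact_length]
      split_ifs with hK
      · rw [h v ⟨i / 2, hK⟩]
        have : Even (2 * K + 1 - i) := by simpa using hodd
        obtain ⟨m, hm⟩ := this
        simp only
        omega
      · rfl

/-- To bound the acceptance probability, fix all coins but those of the root. -/
theorem acceptProb_le (Q : PublicCoin n K R M E) (ℰ : Encodings l B R M E) (I : Instance n)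
    (root : Fin n) {δ : ℝ}
    (h : ∀ (o : Fin n → Fin K → R) (W : (Fin K → R) → ℕ → Fin n → M), NonAnticipating W →
      prob (fun c => Q.AllAccept I (update o root c) (W c)) ≤ δ) (P : Prover n l) :
    (Q.verifier ℰ).acceptProb P I ≤ δ := by
  unfold Verifier.acceptProb
  apply prob_prod_le (A := Fin n → Fin K → R)
  intro pc
  refine prob_le_of_update (ι := Fin n) (α := Fin K → R) _ root fun o => ?_
  -- With the prover's coins and the other nodes' coins fixed, the decoded execution is itself a
  -- strategy depending on the root's coins. Times beyond `K` decode to a constant, so it is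
  -- non-anticipating at all times.
  refine le_trans (prob_mono fun c hc => ?_)
    (h o (fun c t v => proverMsg Q ℰ P I (update o root c, pc) t v) ?_)
  · intro v
    exact (run_iff Q ℰ P I _ v).1 (hc v)
  · intro c c' t hcc
    funext v
    beta_reduce
    rcases le_or_gt t K with ht | ht
    · rw [proverMsg_eq _ _ _ _ _ ht, proverMsg_eq _ _ _ _ _ ht, roundMsg_even _ _ _ _ _ ht,
        roundMsg_even _ _ _ _ _ ht]
      dsimp only
      rw [interact_congr Q ℰ P I (update o root c) (update o root c') pc]
      intro u j hj
      by_cases hu : u = root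
      · subst hu
        simpa using hcc j (by omega)
      · simp [hu]
    · rw [proverMsg_of_gt _ _ _ _ _ ht, proverMsg_of_gt _ _ _ _ _ ht]

section Honest

variable {PC : Type} [Fintype PC] [Nonempty PC] (Q : PublicCoin n K R M E)
  (ℰ : Encodings l B R M E) (I : Instance n) (root : Fin n)
  (W : PC → (Fin K → R) → ℕ → Fin n → M)

theorem roundMsg_honest (hW : ∀ pc, NonAnticipating (W pc))
    (ω : (Q.verifier ℰ).Sample (honest ℰ root W)) {t : ℕ} (ht : t ≤ K) (v : Fin n) :
    roundMsg (Q.verifier ℰ) (honest ℰ root W) I ω (2 * t) v =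
      ℰ.message (W ω.2 (ω.1 root) t v) := by
  rw [roundMsg_even _ _ _ _ _ ht]
  rw [honest_next, interact_length, show 2 * t / 2 = t by omega]
  congr 1
  refine congrFun (hW _ _ _ _ fun j hj => ?_) v
  have h1 : 2 * j.val + 1 < 2 * t := by omega
  simp only [interact_eq, List.getD, List.getElem?_map, List.getElem?_range h1]
  simp only [Option.map_some, Option.getD_some]
  rw [roundMsg_odd Q ℰ (honest ℰ root W) I ω j.isLt root, leftInverse_invFun ℰ.challenge.injective]

theorem proverMsg_honest (hW : ∀ pc, NonAnticipating (W pc))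
    (ω : (Q.verifier ℰ).Sample (honest ℰ root W)) {t : ℕ} (ht : t ≤ K) (v : Fin n) :
    proverMsg Q ℰ (honest ℰ root W) I ω t v = W ω.2 (ω.1 root) t v := by
  rw [proverMsg_eq _ _ _ _ _ ht, roundMsg_honest _ _ _ _ _ hW _ ht,
    leftInverse_invFun ℰ.message.injective]

end Honest

end PublicCoin

end DistZK

/-! ### Perfect simulation of public-coin protocols -/

namespace DistZK

open Function

namespace PublicCoin

variable {n K l B : ℕ} {R M E : Type} [Fintype R] [Nonempty R] [Nonempty M] [Nonempty E]
  {PC : Type} [Fintype PC] [Nonempty PC] (Q : PublicCoin n K R M E)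
  (ℰ : Encodings l B R M E) (I : Instance n) (root : Fin n)
  (W : PC → (Fin K → R) → ℕ → Fin n → M)

theorem acceptProb_honest (hW : ∀ pc, NonAnticipating (W pc))
    (h : ∀ pc coins w, (∀ t ≤ K, ∀ v, w t v = W pc (coins root) t v) → Q.AllAccept I coins w) :
    (Q.verifier ℰ).acceptProb (honest ℰ root W) I = 1 := by
  refine prob_of_forall fun ω v => ?_
  rw [run_iff]
  exact h ω.2 ω.1 (proverMsg Q ℰ (honest ℰ root W) I ω)
    (fun t ht v => proverMsg_honest Q ℰ I root W hW ω ht v) v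

variable (simSend : LocalInput n → Fin n → E)
  (simMsg : LocalInput n → (Fin n → Option E) → (Fin n → Fin K → R) × PC → ℕ → M)
  (simEdge : LocalInput n → (Fin n → Option E) → (Fin n → Fin K → R) × PC → Fin n → E)

open Classical in
/-- A simulator in which every node sends `simSend` to its neighbours, and then samples on its own
the coins of all nodes and of the prover, and computes its view from them. -/
noncomputable abbrev simulator : Simulator n 1 B (View n l B (Q.verifier ℰ).Coin) where
  Coin := (Fin n → Fin K → R) × PC
  alg :=
    { send := fun x _ u => ℰ.edge (simSend x.1 u)
      output := fun x m =>
        let inb : Fin n → Option E := fun u =>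
          ((m.headD fun _ => none) u).map (invFun ℰ.edge)
        { coin := x.2.1 x.1.id
          interaction := (List.range (2 * K + 1)).map fun j =>
            if Even j then ℰ.message (simMsg x.1 inb x.2 (j / 2))
            else if h : j / 2 < K then ℰ.challenge (x.2.1 x.1.id ⟨j / 2, h⟩) else default
          inbox := [fun u => if u ∈ x.1.nbrs then some (ℰ.edge (simEdge x.1 inb x.2 u))
            else none] } }

open Classical in
/-- What the node `v` receives in the simulation. -/
noncomputable def simReceived (v u : Fin n) : Option E :=
  if I.graph.Adj u v then some (simSend (I.localInput u) v) else none

open Classical in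
/-- The view computed by the simulator at `v` from the sample `ω`. -/
noncomputable def simView (v : Fin n) (ω : (Fin n → Fin K → R) × PC) :
    View n l B (Q.verifier ℰ).Coin where
  coin := ω.1 v
  interaction := (List.range (2 * K + 1)).map fun j =>
    if Even j then ℰ.message (simMsg (I.localInput v) (simReceived I simSend v) ω (j / 2))
    else if h : j / 2 < K then ℰ.challenge (ω.1 v ⟨j / 2, h⟩) else default
  inbox := [fun u => if I.graph.Adj u v then
    some (ℰ.edge (simEdge (I.localInput v) (simReceived I simSend v) ω u)) else none]

theorem simulator_out (v : Fin n) (ω : Fin n → (Fin n → Fin K → R) × PC) :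
    (simulator Q ℰ simSend simMsg simEdge).out I v ω =
      simView Q ℰ I simSend simMsg simEdge v (ω v) := by
  classical
  have h : (fun u => (((((simulator Q ℰ simSend simMsg simEdge).alg.inbox I.graph
      (fun u => (I.localInput u, ω u)) 1 v).headD fun _ => none) u).map
      (invFun ℰ.edge))) = simReceived I simSend v := by
    funext u
    by_cases h : I.graph.Adj u v
    · simp [simReceived, h, leftInverse_invFun ℰ.edge.injective _, DistAlg.inbox]
    · simp [simReceived, h, DistAlg.inbox]
  unfold simView
  rw [← h]
  simp only [Simulator.out, DistAlg.run, Instance.localInput, SimpleGraph.mem_neighborSet,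
    I.graph.adj_comm v]

/-- A bijection of the sample space that carries the real view to the simulated one pointwise makes
the two laws equal. As `Φ` keeps the verifier's coins, only prover messages and edge messages have
to be matched. -/
theorem tvDist_view_eq_zero (hW : ∀ pc, NonAnticipating (W pc)) (v : Fin n)
    (Φ : (Fin n → Fin K → R) × PC → (Fin n → Fin K → R) × PC) (hΦ : Bijective Φ)
    (hcoin : ∀ ω, (Φ ω).1 = ω.1)
    (hmsg : ∀ ω : (Fin n → Fin K → R) × PC, ∀ t ≤ K, W ω.2 (ω.1 root) t v =
      simMsg (I.localInput v) (simReceived I simSend v) (Φ ω) t)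
    (hedge : ∀ (ω : (Fin n → Fin K → R) × PC) (w : ℕ → Fin n → M),
      (∀ t ≤ K, ∀ u, w t u = W ω.2 (ω.1 root) t u) → ∀ u, I.graph.Adj u v →
      Q.send (I.localInput u) (ω.1 u) (fun t => w t u) v =
        simEdge (I.localInput v) (simReceived I simSend v) (Φ ω) u) :
    tvDist ((simulator Q ℰ simSend simMsg simEdge).out I v)
      ((Q.verifier ℰ).view (honest ℰ root W) I v) = 0 := by
  classical
  have hview : ∀ ω : (Fin n → Fin K → R) × PC,
      (Q.verifier ℰ).view (honest ℰ root W) I v ω =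
        simView Q ℰ I simSend simMsg simEdge v (Φ ω) := by
    intro ω
    have h1 : ((Q.verifier ℰ).view (honest ℰ root W) I v ω).interaction =
        (simView Q ℰ I simSend simMsg simEdge v (Φ ω)).interaction := by
      simp only [Verifier.view, Verifier.nodeInteraction, interact_eq, simView, List.map_map]
      refine List.map_congr_left fun j hj => ?_
      rw [List.mem_range] at hj
      simp only [comp_apply]
      split_ifs with he hK
      · obtain ⟨t, rfl⟩ := he
        rw [← two_mul] at hj ⊢
        rw [roundMsg_honest Q ℰ I root W hW ω (by omega : t ≤ K), hmsg ω t (by omega),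
          show 2 * t / 2 = t by omega]
      · obtain ⟨t, rfl⟩ := Nat.not_even_iff_odd.1 he
        rw [roundMsg_odd Q ℰ (honest ℰ root W) I ω (by omega : t < K) v, hcoin]
        simp only [show (2 * t + 1) / 2 = t by omega]
      · exfalso
        obtain ⟨t, rfl⟩ := Nat.not_even_iff_odd.1 he
        omega
    have h2 : ((Q.verifier ℰ).view (honest ℰ root W) I v ω).inbox =
        (simView Q ℰ I simSend simMsg simEdge v (Φ ω)).inbox := by
      rw [view_inbox]
      simp only [simView]
      congr 1
      funext u
      split_ifs with hu
      · rw [hedge ω (proverMsg Q ℰ (honest ℰ root W) I ω)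
          (fun t ht v => proverMsg_honest Q ℰ I root W hW ω ht v) u hu]
      · rfl
    have h3 : ((Q.verifier ℰ).view (honest ℰ root W) I v ω).coin =
        (simView Q ℰ I simSend simMsg simEdge v (Φ ω)).coin := by
      simp only [Verifier.view, simView, hcoin]
    rcases hv : (Q.verifier ℰ).view (honest ℰ root W) I v ω with ⟨a, b, c⟩
    rcases hs : simView Q ℰ I simSend simMsg simEdge v (Φ ω) with ⟨a', b', c'⟩
    rw [hv, hs] at h1 h2 h3
    subst h1 h2 h3
    rfl
  have hA : ∀ A : Set (View n l B (Q.verifier ℰ).Coin),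
      prob (fun ω => (simulator Q ℰ simSend simMsg simEdge).out I v ω ∈ A) =
        prob (fun ω => (Q.verifier ℰ).view (honest ℰ root W) I v ω ∈ A) := by
    intro A
    refine (congrArg prob (funext fun ω => congrArg (· ∈ A)
      (simulator_out Q ℰ I simSend simMsg simEdge v ω))).trans ?_
    -- The output at `v` uses only the private sample of `v`, which is itself a complete sample of
    -- an execution.
    refine (prob_comp_eval (fun x => simView Q ℰ I simSend simMsg simEdge v x ∈ A) v).trans ?_
    refine (prob_comp_bijective
      (fun x => simView Q ℰ I simSend simMsg simEdge v x ∈ A) hΦ).symm.trans ?_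
    congr 1
    funext ω
    rw [← hview]
  simp [tvDist, hA]

end PublicCoin

end DistZK

namespace DistZK

/-! ### The sum-check polynomials -/

open Function Polynomial

section Sumcheck

variable {F : Type} [Field F] {n k : ℕ} (α : Fin n → F)

/-- The polynomial that vanishes at the nodes. -/
noncomputable def vanishing : F[X] := ∏ v, (X - C (α v))

/-- The value at `x` of the polynomial that is `1` at the node `u` and `0` at the others. -/
noncomputable def lagr (u : Fin n) (x : F) : F := (Lagrange.basis Finset.univ α u).eval x

theorem eval_vanishing_ne_zero {x : F} (hx : ∀ v, x ≠ α v) : (vanishing α).eval x ≠ 0 := by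
  simp only [vanishing, eval_prod, eval_sub, eval_X, eval_C]
  exact Finset.prod_ne_zero_iff.2 fun v _ => sub_ne_zero.2 (hx v)

theorem eval_vanishing_node (v : Fin n) : (vanishing α).eval (α v) = 0 := by
  simp only [vanishing, eval_prod, eval_sub, eval_X, eval_C]
  exact Finset.prod_eq_zero (Finset.mem_univ v) (sub_self _)

theorem natDegree_vanishing_le : (vanishing α).natDegree ≤ n := by
  refine (natDegree_prod_le _ _).trans ?_
  simp

theorem lagr_node {α : Fin n → F} (hα : Injective α) (u v : Fin n) :
    lagr α u (α v) = if u = v then 1 else 0 := by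
  unfold lagr
  split_ifs with h
  · subst h
    exact Lagrange.eval_basis_self hα.injOn (Finset.mem_univ _)
  · exact Lagrange.eval_basis_of_ne h (Finset.mem_univ _)

/-- The bivariate extension of the matrix `M`, masked by a multiple of a polynomial that vanishes
at the nodes. -/
noncomputable def maskedEntry (M : Fin n → Fin n → F) (ρ x y : F) : F :=
  ∑ v, ∑ u, lagr α v y * (lagr α u x * M u v) +
    ρ * ((vanishing α).eval x * (vanishing α).eval y)

theorem maskedEntry_node {α : Fin n → F} (hα : Injective α) (M : Fin n → Fin n → F) (ρ : F)
    (u v : Fin n) : maskedEntry α M ρ (α u) (α v) = M u v := by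
  simp [maskedEntry, lagr_node hα, eval_vanishing_node]

/-- Transposition lets the degree bound in the first argument serve for the second. -/
theorem maskedEntry_swap (M : Fin n → Fin n → F) (ρ x y : F) :
    maskedEntry α M ρ x y = maskedEntry α (fun u v => M v u) ρ y x := by
  unfold maskedEntry
  rw [Finset.sum_comm]
  congr 1
  · exact Finset.sum_congr rfl fun _ _ => Finset.sum_congr rfl fun _ _ => by ring
  · ring

theorem exists_poly_maskedEntry {α : Fin n → F} (hα : Injective α) (M : Fin n → Fin n → F)
    (ρ y : F) : ∃ P : F[X], P.natDegree ≤ n ∧ ∀ x, P.eval x = maskedEntry α M ρ x y := by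
  refine ⟨∑ v, ∑ u, C (lagr α v y * M u v) * Lagrange.basis Finset.univ α u +
    C (ρ * (vanishing α).eval y) * vanishing α, ?_, fun x => ?_⟩
  · refine natDegree_add_le_of_degree_le (natDegree_sum_le_of_forall_le _ _ fun v _ =>
      natDegree_sum_le_of_forall_le _ _ fun u _ => ?_) ?_
    · refine (natDegree_C_mul_le _ _).trans ?_
      rw [Lagrange.natDegree_basis hα.injOn (Finset.mem_univ _)]
      simp
    · exact (natDegree_C_mul_le _ _).trans (natDegree_vanishing_le α)
  · simp only [eval_add, eval_finsetSum, eval_mul, eval_C, maskedEntry, lagr]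
    congr 1
    · exact Finset.sum_congr rfl fun _ _ => Finset.sum_congr rfl fun _ _ => by ring
    · ring

/-- The pairs of pattern vertices. -/
def pairs (k : ℕ) : Finset (Fin k × Fin k) := Finset.univ.filter fun q => q.1 < q.2

/-- The product of the masked entries over all pairs of pattern vertices. -/
noncomputable def pattern (M : Fin k → Fin k → Fin n → Fin n → F) (ρ : Fin k → Fin k → F)
    (x : Fin k → F) : F :=
  ∏ q ∈ pairs k, maskedEntry α (M q.1 q.2) (ρ q.1 q.2) (x q.1) (x q.2)

/-- A pair through `i` is determined by its other member. Hence the pattern polynomial has degree at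
most `(k - 1) * n` in each variable. -/
theorem card_pairs_through (i : Fin k) :
    ((pairs k).filter fun q => q.1 = i ∨ q.2 = i).card ≤ k - 1 := by
  have : (Finset.univ.erase i).card = k - 1 := by simp
  rw [← this]
  refine Finset.card_le_card_of_injOn (fun q => if q.1 = i then q.2 else q.1) ?_ ?_
  · intro q hq
    simp only [pairs, Finset.mem_filter, Finset.mem_univ, true_and, Finset.coe_filter,
      Set.mem_ofPred_eq] at hq
    simp only [Finset.coe_erase, Finset.coe_univ, Set.mem_sdiff, Set.mem_univ, true_and,
      Set.mem_singleton_iff]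
    split_ifs with h
    · rw [← h]
      exact hq.1.ne'
    · exact h
  · rintro ⟨a, b⟩ hq ⟨a', b'⟩ hq' h
    simp only [pairs, Finset.mem_filter, Finset.mem_univ, true_and, Finset.coe_filter,
      Set.mem_ofPred_eq] at hq hq' h
    obtain ⟨h1, h2⟩ := hq
    obtain ⟨h3, h4⟩ := hq'
    split_ifs at h <;> grind

theorem exists_poly_pattern {α : Fin n → F} (hα : Injective α)
    (M : Fin k → Fin k → Fin n → Fin n → F) (ρ : Fin k → Fin k → F) (x : Fin k → F) (i : Fin k) :
    ∃ P : F[X], P.natDegree ≤ (k - 1) * n ∧ ∀ y, P.eval y = pattern α M ρ (update x i y) := by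
  have h : ∀ q ∈ pairs k, ∃ P : F[X], P.natDegree ≤ (if q.1 = i ∨ q.2 = i then n else 0) ∧
      ∀ y, P.eval y = maskedEntry α (M q.1 q.2) (ρ q.1 q.2) (update x i y q.1)
        (update x i y q.2) := by
    rintro ⟨a, b⟩ hq
    simp only [pairs, Finset.mem_filter, Finset.mem_univ, true_and] at hq
    by_cases ha : a = i
    · subst ha
      obtain ⟨P, hP, hP'⟩ := exists_poly_maskedEntry hα (M a b) (ρ a b) (x b)
      exact ⟨P, by simpa using hP, fun y => by simp [hP', hq.ne']⟩
    · by_cases hb : b = i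
      · subst hb
        obtain ⟨P, hP, hP'⟩ := exists_poly_maskedEntry hα (fun u v => M a b v u) (ρ a b) (x a)
        refine ⟨P, by simpa using hP, fun y => ?_⟩
        rw [hP', maskedEntry_swap]
        simp [hq.ne]
      · exact ⟨C (maskedEntry α (M a b) (ρ a b) (x a) (x b)), by simp, fun y => by
          simp [ha, hb]⟩
  choose! P hP hP' using h
  refine ⟨∏ q ∈ pairs k, P q, ?_, fun y => ?_⟩
  · refine (natDegree_prod_le _ _).trans ((Finset.sum_le_sum hP).trans ?_)
    rw [← Finset.sum_filter, Finset.sum_const, smul_eq_mul]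
    exact Nat.mul_le_mul_right _ (card_pairs_through i)
  · rw [eval_prod, pattern]
    exact Finset.prod_congr rfl fun q hq => hP' q hq y

/-- The sum of `f` over all values at the nodes of the variables from `i` on. The factor makes up
for the summation over the other variables. -/
noncomputable def partialSum (f : (Fin k → F) → F) (i : ℕ) (r : Fin k → F) : F :=
  ((n : F) ^ i)⁻¹ * ∑ w : Fin k → Fin n, f fun j => if j.val < i then r j else α (w j)

theorem partialSum_congr (f : (Fin k → F) → F) (i : ℕ) {r r' : Fin k → F}
    (h : ∀ j : Fin k, j.val < i → r j = r' j) : partialSum α f i r = partialSum α f i r' := by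
  unfold partialSum
  congr 1
  refine Finset.sum_congr rfl fun w _ => congrArg f (funext fun j => ?_)
  split_ifs with hj
  · exact h j hj
  · rfl

theorem partialSum_zero (f : (Fin k → F) → F) (r : Fin k → F) :
    partialSum α f 0 r = ∑ w : Fin k → Fin n, f fun j => α (w j) := by
  simp [partialSum]

theorem partialSum_top (hn : (n : F) ≠ 0) (f : (Fin k → F) → F) (r : Fin k → F) :
    partialSum α f k r = f r := by
  simp [partialSum, hn]

/-- After the variable `i` is set to a node, the sum over `w i` is idle in one place and restored in
the other; the resulting factor `n` is absorbed by the extra `n⁻¹`. -/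
theorem partialSum_step (hn : (n : F) ≠ 0) (f : (Fin k → F) → F) (i : Fin k) (r : Fin k → F) :
    ∑ v, partialSum α f (i + 1) (update r i (α v)) = partialSum α f i r := by
  unfold partialSum
  rw [← Finset.mul_sum, Finset.sum_comm]
  have h := sum_sum_update (fun w : Fin k → Fin n =>
    f fun j => if j.val < i.val then r j else α (w j)) i
  have h' : ∀ (w : Fin k → Fin n) (v : Fin n),
      (fun j : Fin k => if j.val < i.val + 1 then update r i (α v) j else α (w j)) =
      fun j => if j.val < i.val then r j else α (update w i v j) := by
    intro w v
    funext j
    by_cases hj : j = i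
    · subst hj
      simp
    · have : j.val ≠ i.val := fun h => hj (Fin.ext h)
      have h2 : j.val < i.val + 1 ↔ j.val < i.val := by omega
      simp [hj, h2]
  simp only [h', h, Fintype.card_fin, nsmul_eq_mul]
  rw [pow_succ]
  field_simp

theorem exists_poly_partialSum {f : (Fin k → F) → F} {d : ℕ} (i : Fin k)
    (hf : ∀ x, ∃ P : F[X], P.natDegree ≤ d ∧ ∀ y, P.eval y = f (update x i y)) (r : Fin k → F) :
    ∃ P : F[X], P.natDegree ≤ d ∧
      ∀ y, P.eval y = partialSum α f (i + 1) (update r i y) := by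
  choose P hP hP' using hf
  refine ⟨C (((n : F) ^ (i.val + 1))⁻¹) *
    ∑ w : Fin k → Fin n, P fun j => if j.val < i.val + 1 then r j else α (w j), ?_, fun y => ?_⟩
  · exact (natDegree_C_mul_le _ _).trans (natDegree_sum_le_of_forall_le _ _ fun w _ => hP _)
  · simp only [eval_mul, eval_C, eval_finsetSum, hP', partialSum]
    congr 1
    refine Finset.sum_congr rfl fun w _ => congrArg f (funext fun j => ?_)
    by_cases hj : j = i
    · subst hj
      simp
    · simp [hj]

/-- The polynomial that an honest prover commits to in the sum-check round of the variable `i`. -/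
noncomputable def roundPoly (M : Fin k → Fin k → Fin n → Fin n → F) (ρ : Fin k → Fin k → F)
    (i : Fin k) (r : Fin k → F) : F[X] :=
  -- Choosing by `epsilon` makes the polynomial a function of its defining property alone, so it
  -- visibly depends only on the challenges before `i`.
  Classical.epsilon fun P : F[X] => P.natDegree ≤ (k - 1) * n ∧
    ∀ y, P.eval y = partialSum α (pattern α M ρ) (i + 1) (update r i y)

section RoundPoly

variable {α} (M : Fin k → Fin k → Fin n → Fin n → F) (ρ : Fin k → Fin k → F)
  (i : Fin k) (r : Fin k → F)

theorem roundPoly_spec (hα : Injective α) : (roundPoly α M ρ i r).natDegree ≤ (k - 1) * n ∧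
    ∀ y, (roundPoly α M ρ i r).eval y =
      partialSum α (pattern α M ρ) (i + 1) (update r i y) :=
  Classical.epsilon_spec
    (exists_poly_partialSum α i (fun x => exists_poly_pattern hα M ρ x i) r)

theorem eval_roundPoly_self (hα : Injective α) :
    (roundPoly α M ρ i r).eval (r i) = partialSum α (pattern α M ρ) (i + 1) r := by
  rw [(roundPoly_spec M ρ i r hα).2, update_eq_self]

theorem sum_eval_roundPoly (hα : Injective α) (hn : (n : F) ≠ 0) :
    ∑ v, (roundPoly α M ρ i r).eval (α v) = partialSum α (pattern α M ρ) i r := by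
  simp only [(roundPoly_spec M ρ i r hα).2]
  exact partialSum_step α hn _ i r

end RoundPoly

theorem roundPoly_congr (M : Fin k → Fin k → Fin n → Fin n → F) (ρ : Fin k → Fin k → F)
    (i : Fin k) {r r' : Fin k → F} (h : ∀ j : Fin k, j < i → r j = r' j) :
    roundPoly α M ρ i r = roundPoly α M ρ i r' := by
  unfold roundPoly
  congr 1
  funext P
  have : ∀ y, partialSum α (pattern α M ρ) (i + 1) (update r i y) =
      partialSum α (pattern α M ρ) (i + 1) (update r' i y) := by
    intro y
    refine partialSum_congr α _ _ fun j hj => ?_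
    by_cases hji : j = i
    · subst hji
      simp
    · have hlt : j < i := lt_of_le_of_ne (Fin.le_def.2 (by omega)) hji
      simp [hji, h j hlt]
  simp only [this]

/-- A cheating prover passes the consistency checks only if in some round the committed polynomial
differs from the right one but agrees with it at the challenge. -/
theorem exists_bad_round {α : Fin n → F} (hα : Injective α) (hn : (n : F) ≠ 0)
    (M : Fin k → Fin k → Fin n → Fin n → F) (ρ : Fin k → Fin k → F) (r : Fin k → F)
    (h : Fin k → F[X]) (claim : ℕ → F)
    (hclaim : ∀ i : Fin k, claim (i + 1) = (h i).eval (r i))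
    (hsum : ∀ i : Fin k, ∑ v, (h i).eval (α v) = claim i)
    (htop : pattern α M ρ r = claim k)
    (hne : claim 0 ≠ partialSum α (pattern α M ρ) 0 r) :
    ∃ i : Fin k, h i ≠ roundPoly α M ρ i r ∧
      (h i).eval (r i) = (roundPoly α M ρ i r).eval (r i) := by
  by_contra! hcon
  -- Backward induction: a right claim after round `i` forces, if no round is bad, the right
  -- polynomial in round `i`, and thus the right claim before it.
  have key : ∀ m ≤ k, claim (k - m) = partialSum α (pattern α M ρ) (k - m) r := by
    intro m
    induction m with
    | zero => intro _; simp [← htop, partialSum_top α hn]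
    | succ m ih =>
      intro hm
      have hi : k - (m + 1) < k := by omega
      have hs : k - m = (⟨k - (m + 1), hi⟩ : Fin k).val + 1 := by simp only; omega
      have h1 := ih (by omega)
      rw [hs, hclaim, ← eval_roundPoly_self _ _ _ _ hα] at h1
      have h2 := not_imp_not.1 (hcon ⟨k - (m + 1), hi⟩) h1
      have h3 := hsum ⟨k - (m + 1), hi⟩
      rw [h2, sum_eval_roundPoly _ _ _ _ hα hn] at h3
      exact h3.symm
  exact hne (by simpa using key k le_rfl)

/-! ### Distributed coefficients -/

/-- The polynomial with the coefficients `D`, the node `b` being responsible for `k` of them. -/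
noncomputable def coefPoly (D : Fin n → Fin k → F) : F[X] :=
  ∑ b, ∑ j, C (D b j) * X ^ (b.val + n * j.val)

theorem eval_coefPoly (D : Fin n → Fin k → F) (x : F) :
    (coefPoly D).eval x = ∑ b, ∑ j, D b j * x ^ (b.val + n * j.val) := by
  simp [coefPoly, eval_finsetSum]

theorem natDegree_coefPoly_le (D : Fin n → Fin k → F) : (coefPoly D).natDegree ≤ n * k := by
  refine natDegree_sum_le_of_forall_le _ _ fun b _ => natDegree_sum_le_of_forall_le _ _
    fun j _ => (natDegree_C_mul_X_pow_le _ _).trans ?_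
  have h1 := b.isLt
  have h2 : n * (j.val + 1) ≤ n * k := Nat.mul_le_mul_left _ j.isLt
  rw [mul_add] at h2
  omega

/-- Division by `n` writes every exponent below `k * n` uniquely as `b + n * j`, so `k` slots per
node hold any round polynomial. -/
theorem coefPoly_coeff {P : F[X]} (hP : P.natDegree < k * n) :
    coefPoly (fun (b : Fin n) (j : Fin k) => P.coeff (b.val + n * j.val)) = P := by
  conv_rhs => rw [P.as_sum_range_C_mul_X_pow' hP, Finset.sum_range]
  rw [coefPoly, Finset.sum_comm, ← Fintype.sum_prod_type']
  exact Fintype.sum_equiv finProdFinEquiv _ _ fun x => by simp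

end Sumcheck

/-- Root counting for a uniform challenge; all soundness error of the protocol comes from here. -/
theorem card_roots_le {F : Type} [Field F] [Fintype F] {S : F → Prop} {P : F[X]} (hP : P ≠ 0)
    {d : ℕ} (hd : P.natDegree ≤ d) (R : {x // S x} → Prop)
    (hR : ∀ x, R x → P.eval x.1 = 0) [Fintype {x // S x}] :
    prob R ≤ d / Fintype.card {x // S x} := by
  classical
  unfold prob
  gcongr
  refine le_trans ?_ ((P.card_roots' ).trans hd)
  refine le_trans ?_ (Multiset.toFinset_card_le P.roots)
  refine Finset.card_le_card_of_injOn Subtype.val ?_ Subtype.val_injective.injOn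
  intro x hx
  simp only [Finset.coe_filter, Finset.mem_univ, true_and, Set.mem_ofPred_eq] at hx
  simpa [hP] using hR x hx

/-! ### The pattern of a graph -/

section Entries

variable {n k : ℕ} (F : Type) [Field F] (κ : CopyKind) (H : SimpleGraph (Fin k))

open Classical in
/-- The row, at a node, of the matrix for the pair `a`, `b` of pattern vertices. -/
noncomputable def localEntry (li : LocalInput n) (a b : Fin k) (u : Fin n) : F :=
  if u ≠ li.id ∧ PairOk κ H a b (u ∈ li.nbrs) then 1 else 0

/-- The matrix for the pair `a`, `b` of pattern vertices. -/
noncomputable def entry (I : Instance n) (a b : Fin k) (u v : Fin n) : F :=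
  localEntry F κ H (I.localInput v) a b u

/-- The product of the entries is the indicator of `IsLabelledCopy`: the condition `u ≠ li.id`
accounts for injectivity, `PairOk` for adjacency. -/
theorem sum_prod_entry (I : Instance n) :
    ∑ w : Fin k → Fin n, ∏ q ∈ pairs k, entry F κ H I q.1 q.2 (w q.1) (w q.2) =
      ((Nat.card (H ≃g H) * numCopies κ H I.graph : ℕ) : F) := by
  classical
  rw [← card_isLabelledCopy, Nat.card_eq_fintype_card, Fintype.card_subtype,
    Finset.card_eq_sum_ones, Nat.cast_sum, Finset.sum_filter]
  refine Finset.sum_congr rfl fun w _ => ?_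
  simp only [entry, localEntry, Instance.localInput, SimpleGraph.mem_neighborSet, Nat.cast_one]
  split_ifs with h
  · refine Finset.prod_eq_one fun q hq => if_pos ?_
    simp only [pairs, Finset.mem_filter, Finset.mem_univ, true_and] at hq
    rw [I.graph.adj_comm]
    exact h q.1 q.2 hq
  · unfold IsLabelledCopy at h
    push Not at h
    obtain ⟨a, b, hab, h⟩ := h
    refine Finset.prod_eq_zero (i := (a, b)) (by simpa [pairs] using hab) (if_neg ?_)
    rw [I.graph.adj_comm]
    exact fun hh => h hh.1 hh.2

/-- The true count passes the nodes' range check, and two numbers in that range cannot be confused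
modulo a prime above `n ^ k`. -/
theorem card_mul_numCopies_le (G : SimpleGraph (Fin n)) :
    Nat.card (H ≃g H) * numCopies κ H G ≤ n ^ k := by
  rw [← card_isLabelledCopy]
  refine (Nat.card_le_card_of_injective _ Subtype.val_injective).trans ?_
  simp

end Entries

end DistZK

namespace DistZK

/-! ### The protocol -/

open Function Polynomial

/-- The data of a node in the protocol: its shares `X`, `Y` of the coefficients of the sum-check
polynomials (indexed by round and slot), its shares `N` of the masks and the claimed masked entries
`U` (both indexed by `b` and `a`, for the pair `a < b`), and the sum-check challenges `r`. -/
structure Tables (k : ℕ) (F : Type) where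
  X : Fin k → Fin k → F
  Y : Fin k → Fin k → F
  N : Fin k → Fin k → F
  U : Fin k → Fin k → F
  r : Fin k → F

/-- A prover message to a node: rows of the four tables, a challenge, the mask of the node for the
final summation, the sum of these masks, and the masked sum over the subtree of the node. -/
abbrev Msg (k : ℕ) (F : Type) : Type := (Fin 4 → Fin k → F) × (Fin 4 → F)

/-- A message to a neighbour: the last challenge, a fingerprint of the others, and a subtree sum. -/
abbrev EdgeMsg (F : Type) : Type := F × F × F

/-- Challenges are not at the nodes. -/
abbrev Challenge {F : Type} {n : ℕ} (α : Fin n → F) : Type := {x : F // ∀ v, x ≠ α v}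

/-- The indices of the linear checks. -/
abbrev CheckIndex (k : ℕ) : Type := Fin (k + 1) ⊕ Fin k × Fin k

/-- The exponent of a linear check in the random linear combination. -/
noncomputable def checkExp {k : ℕ} (j : CheckIndex k) : ℕ := (Fintype.equivFin _ j).val + 1

theorem checkExp_injective {k : ℕ} : Injective (checkExp (k := k)) := by
  intro i j h
  exact (Fintype.equivFin _).injective (Fin.ext (Nat.succ_injective h))

theorem checkExp_le {k : ℕ} (j : CheckIndex k) : checkExp j ≤ k + 1 + k * k := by
  have := (Fintype.equivFin (CheckIndex k) j).isLt
  simp only [Fintype.card_sum, Fintype.card_fin, Fintype.card_prod] at this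
  exact this

section Protocol

variable {F : Type} [Field F] {n k : ℕ}

/-- The tables contained in the prover messages. -/
def readTables (w : ℕ → Msg k F) : Tables k F where
  -- The schedule: mask shares at times `0, …, k - 1`; the shares of round `i` at `k + i`, just
  -- before its challenge, which is echoed at `k + i + 1`; row `b` of `U` at `k + 1 + b`, once the
  -- challenges up to `b` are known. Sending a row at a time keeps messages at `O(k)` field
  -- elements.
  X i := (w (k + i)).1 0
  Y i := (w (k + i)).1 1
  N b := (w b).1 2
  U b := (w (k + 1 + b)).1 3
  r i := (w (k + i + 1)).2 0

/-- The contribution of a node to the value at `x` of a shared polynomial. -/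
def localEval (v : Fin n) (X Y : Fin k → F) (x : F) : F :=
  ∑ j, (X j * x ^ (v.val + n * j.val) + Y j * x ^ ((finRotate n v).val + n * j.val))

/-- Node `v` holds the first shares of its own coefficients and the second shares of its successor's
under `finRotate`; reindexing along the rotation brings both shares together. -/
theorem sum_localEval (X Y : Fin n → Fin k → F) (x : F) :
    ∑ v, localEval v (X v) (Y v) x =
      (coefPoly fun b j => X b j + Y ((finRotate n).symm b) j).eval x := by
  simp only [eval_coefPoly, localEval, add_mul, Finset.sum_add_distrib]
  congr 1
  refine Fintype.sum_equiv (finRotate n) _ _ fun v => ?_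
  simp only [Equiv.symm_apply_apply]

variable (α : Fin n → F) (κ : CopyKind) (H : SimpleGraph (Fin k))

/-- The contribution of a node to the left-hand side of a sum-check equation. -/
noncomputable def localLhs (li : LocalInput n) (T : Tables k F) : Fin (k + 1) → F :=
  Fin.lastCases (if li.id.val = 0 then ∏ q ∈ pairs k, T.U q.2 q.1 else 0)
    fun i => ∑ u, localEval li.id (T.X i) (T.Y i) (α u)

/-- The contribution of a node to the right-hand side of a sum-check equation. -/
noncomputable def localRhs (li : LocalInput n) (T : Tables k F) : Fin (k + 1) → F :=
  Fin.cases (if li.id.val = 0 then ((Nat.card (H ≃g H) * li.target : ℕ) : F) else 0)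
    fun i => localEval li.id (T.X i) (T.Y i) (T.r i)

/-- The contribution of a node to the check of a claimed masked entry. -/
noncomputable def localPairCheck (li : LocalInput n) (T : Tables k F) (a b : Fin k) : F :=
  (if li.id.val = 0 then T.U b a else 0) -
    (∑ u, lagr α li.id (T.r b) * (lagr α u (T.r a) * localEntry F κ H li a b u) +
      T.N b a * ((vanishing α).eval (T.r a) * (vanishing α).eval (T.r b)))

/-- The contribution of a node to a linear check. -/
noncomputable def localCheck (li : LocalInput n) (T : Tables k F) : CheckIndex k → F
  | .inl i => localLhs α li T i - localRhs H li T i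
  | .inr (a, b) => if a < b then localPairCheck α κ H li T a b else 0

/-- The contribution of a node to the random linear combination of all linear checks. -/
noncomputable def localComb (li : LocalInput n) (T : Tables k F) (σ : F) : F :=
  ∑ j, σ ^ checkExp j * localCheck α κ H li T j

/-- A fingerprint of the challenges. -/
def fingerprint (r : Fin k → F) (σ : F) : F := ∑ i, r i * σ ^ i.val

/-- The challenges of the sum-check rounds. -/
def sumChallenges {α : Fin n → F} (c : Fin (2 * k + 1) → Challenge α) (i : Fin k) : F :=
  -- The first `k` challenges are dummies that separate the messages carrying the mask shares.
  (c ⟨k + i, by omega⟩).1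

/-- The last challenge. -/
def lastChallenge {α : Fin n → F} (c : Fin (2 * k + 1) → Challenge α) : F :=
  (c ⟨2 * k, by omega⟩).1

/-- The protocol for counting the copies of `H`. -/
noncomputable def protocol :
    PublicCoin n (2 * k + 1) (Challenge α) (Msg k F) (EdgeMsg F) where
  send li _ w u :=
    open Classical in
    ((w (2 * k + 1)).2 0, fingerprint (readTables w).r ((w (2 * k + 1)).2 0),
      if li.parent = u then (w (2 * k + 1)).2 3 else 0)
  accept li c w inb :=
    -- This excludes targets that agree with the true count only modulo the characteristic.
    Nat.card (H ≃g H) * li.target ≤ n ^ k ∧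
    -- Only the root compares with its own coins. It also requires that its subtree sum be the
    -- announced total of the masks, that is, that the combined checks contribute zero.
    (li.id.val = 0 → (readTables w).r = sumChallenges c ∧
      (w (2 * k + 1)).2 0 = lastChallenge c ∧ (w (2 * k + 1)).2 3 = (w 0).2 2) ∧
    (∀ u m, inb u = some m → m.1 = (w (2 * k + 1)).2 0 ∧
      m.2.1 = fingerprint (readTables w).r ((w (2 * k + 1)).2 0)) ∧
    (w (2 * k + 1)).2 3 = localComb α κ H li (readTables w) ((w (2 * k + 1)).2 0) + (w 0).2 1 +
      ∑ u, (inb u).elim 0 fun m => m.2.2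

/-! ### Sums over the spanning tree -/

open Classical in
/-- The sum of `s` over the children of `v`. -/
noncomputable def childSum (I : Instance n) (s : Fin n → F) (v : Fin n) : F :=
  ∑ u, if I.graph.Adj u v ∧ I.parent u = v then s u else 0

theorem Instance.pos (I : Instance n) : 0 < n := by
  obtain ⟨v⟩ := I.connected.nonempty
  exact v.pos

/-- The node with identifier `0`. -/
def Instance.root (I : Instance n) : Fin n := ⟨0, I.pos⟩

theorem Instance.val_eq_zero_iff (I : Instance n) (v : Fin n) : v.val = 0 ↔ v = I.root :=
  ⟨fun h => Fin.ext h, fun h => by rw [h]; rfl⟩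

/-- Every node but the root is a child of exactly one node. The root is its own parent but not its
own neighbour, so it is counted nowhere. -/
theorem sum_childSum (I : Instance n) (s : Fin n → F) :
    ∑ v, childSum I s v = ∑ u, s u - s I.root := by
  classical
  unfold childSum
  rw [Finset.sum_comm, eq_sub_iff_add_eq, ← Finset.sum_erase_add _ s (Finset.mem_univ I.root),
    ← Finset.sum_erase_add _ _ (Finset.mem_univ I.root)]
  have h0 : ∑ v, (if I.graph.Adj I.root v ∧ I.parent I.root = v then s I.root else 0) = 0 := by
    refine Finset.sum_eq_zero fun v _ => if_neg ?_
    rintro ⟨h1, h2⟩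
    rw [I.parent_root _ rfl] at h2
    subst h2
    exact I.graph.irrefl h1
  rw [h0, add_zero]
  congr 1
  refine Finset.sum_congr rfl fun u hu => ?_
  have hu' : u.val ≠ 0 := fun h => (Finset.mem_erase.1 hu).1 ((I.val_eq_zero_iff u).1 h)
  rw [Finset.sum_eq_single (I.parent u)]
  · simp [I.parent_adj u hu']
  · intro v _ hv
    exact if_neg fun h => hv h.2.symm
  · simp

theorem sum_received {α : Fin n → F} {κ : CopyKind} {H : SimpleGraph (Fin k)} (I : Instance n)
    (coins : Fin n → Fin (2 * k + 1) → Challenge α) (w : ℕ → Fin n → Msg k F) (v : Fin n) :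
    ∑ u, ((protocol α κ H).received I
      (fun u => (I.localInput u, coins u, fun t => w t u)) v u).elim 0 (fun m => m.2.2) =
      childSum I (fun u => (w (2 * k + 1) u).2 3) v := by
  classical
  refine Finset.sum_congr rfl fun u _ => ?_
  by_cases h : I.graph.Adj u v <;> simp [PublicCoin.received, h, protocol, Instance.localInput]

section Accept

variable {α κ H} {I : Instance n} {coins : Fin n → Fin (2 * k + 1) → Challenge α}
  {w : ℕ → Fin n → Msg k F}

theorem AllAccept.target_le (h : (protocol α κ H).AllAccept I coins w) :
    Nat.card (H ≃g H) * I.target ≤ n ^ k := (h I.root).1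

/-- The equalities between neighbours propagate along a walk to the root, which knows the true
challenges. -/
theorem AllAccept.fingerprint_eq (h : (protocol α κ H).AllAccept I coins w) (v : Fin n) :
    (w (2 * k + 1) v).2 0 = lastChallenge (coins I.root) ∧
    fingerprint (readTables fun t => w t v).r (lastChallenge (coins I.root)) =
      fingerprint (sumChallenges (coins I.root)) (lastChallenge (coins I.root)) := by
  obtain ⟨h1, h2, -⟩ := (h I.root).2.1 rfl
  have key : ∀ u v, I.graph.Walk u v → (w (2 * k + 1) u).2 0 = (w (2 * k + 1) v).2 0 ∧
      fingerprint (readTables fun t => w t u).r ((w (2 * k + 1) u).2 0) =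
      fingerprint (readTables fun t => w t v).r ((w (2 * k + 1) v).2 0) := by
    intro u v p
    induction p with
    | nil => exact ⟨rfl, rfl⟩
    | @cons u v _ huv p ih =>
      have := (h u).2.2.1 v _ (if_pos huv.symm)
      exact ⟨this.1.symm.trans ih.1, this.2.symm.trans ih.2⟩
  obtain ⟨p⟩ := I.connected.preconnected v I.root
  obtain ⟨h3, h4⟩ := key _ _ p
  rw [h3, h1, h2] at h4
  exact ⟨h3.trans h2, h4⟩

/-- Adding the subtree equations over all nodes cancels every subtree sum except the root's. -/
theorem AllAccept.sum_eq (h : (protocol α κ H).AllAccept I coins w) :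
    ∑ v, (localComb α κ H (I.localInput v) (readTables fun t => w t v)
      (lastChallenge (coins I.root)) + (w 0 v).2 1) = (w 0 I.root).2 2 := by
  have h1 := fun v => (h v).2.2.2
  simp only [sum_received, (AllAccept.fingerprint_eq h _).1] at h1
  have h2 := Finset.sum_congr rfl fun v (_ : v ∈ Finset.univ) => h1 v
  rw [Finset.sum_add_distrib, sum_childSum, ((h I.root).2.1 rfl).2.2] at h2
  linear_combination -h2

end Accept

end Protocol

end DistZK

namespace DistZK

/-! ### Soundness -/

open Function Polynomial

section Checks

variable {F : Type} [Field F] {n k : ℕ} (α : Fin n → F) (κ : CopyKind) (H : SimpleGraph (Fin k))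
  (I : Instance n) (T : Fin n → Tables k F)

/-- The polynomial whose coefficients the nodes share in the round `i`. -/
noncomputable def sharedPoly (T : Fin n → Tables k F) (i : Fin k) : F[X] :=
  coefPoly fun b j => (T b).X i j + (T ((finRotate n).symm b)).Y i j

theorem sum_ite_root (x : Fin n → F) :
    ∑ v, (if (I.localInput v).id.val = 0 then x v else 0) = x I.root := by
  simp [Instance.localInput, I.val_eq_zero_iff]

theorem sum_localLhs_castSucc (i : Fin k) :
    ∑ v, localLhs α (I.localInput v) (T v) i.castSucc =
      ∑ u, (sharedPoly T i).eval (α u) := by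
  simp only [localLhs, Fin.lastCases_castSucc]
  rw [Finset.sum_comm]
  exact Finset.sum_congr rfl fun u _ => sum_localEval (fun v => (T v).X i) (fun v => (T v).Y i) _

theorem sum_localLhs_last :
    ∑ v, localLhs α (I.localInput v) (T v) (Fin.last k) =
      ∏ q ∈ pairs k, (T I.root).U q.2 q.1 := by
  simp only [localLhs, Fin.lastCases_last]
  exact sum_ite_root I fun v => ∏ q ∈ pairs k, (T v).U q.2 q.1

theorem sum_localRhs_zero :
    ∑ v, localRhs H (I.localInput v) (T v) 0 = ((Nat.card (H ≃g H) * I.target : ℕ) : F) := by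
  simp only [localRhs, Fin.cases_zero]
  exact sum_ite_root I fun _ => ((Nat.card (H ≃g H) * I.target : ℕ) : F)

theorem sum_localRhs_succ {r : Fin k → F} (hr : ∀ v, (T v).r = r) (i : Fin k) :
    ∑ v, localRhs H (I.localInput v) (T v) i.succ = (sharedPoly T i).eval (r i) := by
  simp only [localRhs, Fin.cases_succ, hr]
  exact sum_localEval (fun v => (T v).X i) (fun v => (T v).Y i) _

theorem sum_localPairCheck {r : Fin k → F} (hr : ∀ v, (T v).r = r) (a b : Fin k) :
    ∑ v, localPairCheck α κ H (I.localInput v) (T v) a b =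
      (T I.root).U b a -
        maskedEntry α (entry F κ H I a b) (∑ v, (T v).N b a) (r a) (r b) := by
  simp only [localPairCheck, hr, Finset.sum_sub_distrib, Finset.sum_add_distrib, maskedEntry,
    ← Finset.sum_mul]
  rw [sum_ite_root I fun v => (T v).U b a]
  rfl

theorem sum_localComb (σ : F) :
    ∑ v, localComb α κ H (I.localInput v) (T v) σ =
      ∑ j, σ ^ checkExp j * ∑ v, localCheck α κ H (I.localInput v) (T v) j := by
  simp only [localComb, Finset.mul_sum]
  exact Finset.sum_comm

end Checks

section Update

variable {F : Type} {n k : ℕ} {α : Fin n → F}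

theorem sumChallenges_update (c : Fin (2 * k + 1) → Challenge α) (t : Fin (2 * k + 1))
    (x : Challenge α) (i : Fin k) (h : k + i.val ≠ t.val) :
    sumChallenges (update c t x) i = sumChallenges c i := by
  unfold sumChallenges
  rw [update_of_ne]
  exact fun h' => h (congrArg Fin.val h')

theorem strategy_update {W : (Fin (2 * k + 1) → Challenge α) → ℕ → Fin n → Msg k F}
    (hW : PublicCoin.NonAnticipating W) (c : Fin (2 * k + 1) → Challenge α)
    (t : Fin (2 * k + 1)) (x : Challenge α) {s : ℕ} (hs : s ≤ t.val) :
    W (update c t x) s = W c s := by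
  refine hW _ _ _ fun j hj => update_of_ne ?_ _ _
  intro h
  rw [h] at hj
  omega

end Update

section Soundness

variable {F : Type} [Field F] {n k : ℕ} {α : Fin n → F} {κ : CopyKind} {H : SimpleGraph (Fin k)}

theorem partialSum_pattern_entry (hα : Injective α) (I : Instance n) (ρ : Fin k → Fin k → F)
    (r : Fin k → F) : partialSum α (pattern α (entry F κ H I) ρ) 0 r =
      ((Nat.card (H ≃g H) * numCopies κ H I.graph : ℕ) : F) := by
  rw [partialSum_zero, ← sum_prod_entry F κ H I]
  simp only [pattern, maskedEntry_node hα]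

/-- If all linear checks hold, then the prover was lucky in some sum-check round. -/
theorem exists_bad_round_of_checks (hα : Injective α) (hn : (n : F) ≠ 0)
    (hcast : ∀ a b : ℕ, a ≤ n ^ k → b ≤ n ^ k → (a : F) = b → a = b) {I : Instance n}
    (hI : numCopies κ H I.graph ≠ I.target) (htarget : Nat.card (H ≃g H) * I.target ≤ n ^ k)
    {T : Fin n → Tables k F} {r : Fin k → F} (hr : ∀ v, (T v).r = r)
    (hT : ∀ j, ∑ v, localCheck α κ H (I.localInput v) (T v) j = 0) :
    ∃ i : Fin k,
      sharedPoly T i ≠ roundPoly α (entry F κ H I) (fun a b => ∑ v, (T v).N b a) i r ∧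
      (sharedPoly T i).eval (r i) =
        (roundPoly α (entry F κ H I) (fun a b => ∑ v, (T v).N b a) i r).eval (r i) := by
  have hl : ∀ i : Fin (k + 1), ∑ v, localLhs α (I.localInput v) (T v) i =
      ∑ v, localRhs H (I.localInput v) (T v) i := by
    intro i
    have := hT (.inl i)
    simp only [localCheck, Finset.sum_sub_distrib] at this
    exact sub_eq_zero.1 this
  have hp : ∀ q ∈ pairs k, (T I.root).U q.2 q.1 =
      maskedEntry α (entry F κ H I q.1 q.2) (∑ v, (T v).N q.2 q.1) (r q.1) (r q.2) := by
    rintro ⟨a, b⟩ hq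
    have hab : a < b := by simpa [pairs] using hq
    have := hT (.inr (a, b))
    simp only [localCheck, hab, if_true] at this
    rw [sum_localPairCheck α κ H I T hr] at this
    exact sub_eq_zero.1 this
  refine exists_bad_round hα hn _ _ r _
    -- The claim with index `m` is the right-hand side of equation `m`: the scaled target for `m =
    -- 0`, then the values of the shared polynomials at their challenges.
    (fun m => if h : m < k + 1 then ∑ v, localRhs H (I.localInput v) (T v) ⟨m, h⟩ else 0)
    (fun i => ?_) (fun i => ?_) ?_ ?_
  · rw [dif_pos (by omega)]
    exact sum_localRhs_succ H I T hr i
  · rw [dif_pos (by omega), ← sum_localLhs_castSucc α I]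
    exact hl i.castSucc
  · rw [dif_pos (by omega)]
    refine Eq.trans ?_ (hl (Fin.last k))
    rw [sum_localLhs_last]
    exact (Finset.prod_congr rfl hp).symm
  · rw [dif_pos (by omega), partialSum_pattern_entry hα]
    intro h
    have h' := (sum_localRhs_zero H I T).symm.trans h
    have h2 := hcast _ _ htarget (card_mul_numCopies_le κ H I.graph) h'
    have : 0 < Nat.card (H ≃g H) := by
      have : Finite (H ≃g H) := DFunLike.finite _
      exact Nat.card_pos
    exact hI (Nat.eq_of_mul_eq_mul_left this h2.symm)

theorem fingerprint_poly {r r' : Fin k → F} (h : r ≠ r') :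
    ∃ P : F[X], P ≠ 0 ∧ P.natDegree ≤ k ∧
      ∀ σ, P.eval σ = fingerprint r σ - fingerprint r' σ := by
  refine ⟨∑ i : Fin k, C (r i - r' i) * X ^ i.val, ?_, ?_, fun σ => ?_⟩
  · intro h0
    refine h (funext fun i => sub_eq_zero.1 ?_)
    have := congrArg (fun P => P.coeff i.val) h0
    simpa only [finsetSum_coeff, coeff_C_mul_X_pow, Fin.val_inj, Finset.sum_ite_eq,
      Finset.mem_univ, if_true, coeff_zero] using this
  · exact natDegree_sum_le_of_forall_le _ _ fun i _ =>
      (natDegree_C_mul_X_pow_le _ _).trans i.isLt.le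
  · simp [fingerprint, eval_finsetSum, sub_mul]

theorem comb_poly {C' : CheckIndex k → F} (h : ∃ j, C' j ≠ 0) (z : F) :
    ∃ P : F[X], P ≠ 0 ∧ P.natDegree ≤ k + 1 + k * k ∧
      ∀ σ, P.eval σ = ∑ j, σ ^ checkExp j * C' j + z := by
  refine ⟨∑ j, C (C' j) * X ^ checkExp j + C z, ?_, ?_, fun σ => ?_⟩
  · intro h0
    obtain ⟨j, hj⟩ := h
    have := congrArg (fun P => P.coeff (checkExp j)) h0
    -- Exponents start at `1`, so the constant `z`, an error in the prover's announced mask total,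
    -- cannot cancel a failing check.
    have hpos : checkExp j ≠ 0 := Nat.succ_ne_zero _
    simp only [coeff_add, finsetSum_coeff, coeff_C_mul_X_pow, checkExp_injective.eq_iff,
      Finset.sum_ite_eq, Finset.mem_univ, if_true, coeff_C, hpos, if_false, add_zero,
      coeff_zero] at this
    exact hj this
  · refine natDegree_add_le_of_degree_le (natDegree_sum_le_of_forall_le _ _ fun j _ =>
      (natDegree_C_mul_X_pow_le _ _).trans (checkExp_le j)) (by simp)
  · simp only [eval_add, eval_finsetSum, eval_mul, eval_C, eval_pow, eval_X]
    congr 1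
    exact Finset.sum_congr rfl fun _ _ => mul_comm _ _

/-- The tables of the nodes. -/
def tablesOf (w : ℕ → Fin n → Msg k F) (v : Fin n) : Tables k F := readTables fun t => w t v

/-- In the round `i` the shared polynomial is wrong, but right at the challenge. -/
def BadSumRound (κ : CopyKind) (H : SimpleGraph (Fin k)) (I : Instance n)
    (W : (Fin (2 * k + 1) → Challenge α) → ℕ → Fin n → Msg k F) (i : Fin k)
    (c : Fin (2 * k + 1) → Challenge α) : Prop :=
  let G := roundPoly α (entry F κ H I) (fun a b => ∑ v, (tablesOf (W c) v).N b a) i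
    (sumChallenges c)
  sharedPoly (tablesOf (W c)) i ≠ G ∧
    (sharedPoly (tablesOf (W c)) i).eval (sumChallenges c i) = G.eval (sumChallenges c i)

/-- The last challenge hides different challenges or a failing linear check. -/
def BadLastRound (κ : CopyKind) (H : SimpleGraph (Fin k)) (I : Instance n)
    (W : (Fin (2 * k + 1) → Challenge α) → ℕ → Fin n → Msg k F)
    (c : Fin (2 * k + 1) → Challenge α) : Prop :=
  ((∃ v, (tablesOf (W c) v).r ≠ sumChallenges c) ∧
    ∀ v, fingerprint (tablesOf (W c) v).r (lastChallenge c) =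
      fingerprint (sumChallenges c) (lastChallenge c)) ∨
  ((∃ j, ∑ v, localCheck α κ H (I.localInput v) (tablesOf (W c) v) j ≠ 0) ∧
    ∑ j, lastChallenge c ^ checkExp j *
      ∑ v, localCheck α κ H (I.localInput v) (tablesOf (W c) v) j +
      (∑ v, (W c 0 v).2 1 - (W c 0 I.root).2 2) = 0)

/-- Unless the last challenge is bad, equal fingerprints mean equal challenges and a vanishing
combination means that all linear checks hold; a wrong target then needs a lucky sum-check round. -/
theorem AllAccept.bad (hα : Injective α) (hn : (n : F) ≠ 0)
    (hcast : ∀ a b : ℕ, a ≤ n ^ k → b ≤ n ^ k → (a : F) = b → a = b) {I : Instance n}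
    (hI : numCopies κ H I.graph ≠ I.target)
    {W : (Fin (2 * k + 1) → Challenge α) → ℕ → Fin n → Msg k F}
    {o : Fin n → Fin (2 * k + 1) → Challenge α} {c : Fin (2 * k + 1) → Challenge α}
    (h : (protocol α κ H).AllAccept I (update o I.root c) (W c)) :
    (∃ i, BadSumRound κ H I W i c) ∨ BadLastRound κ H I W c := by
  by_contra! hcon
  obtain ⟨hsum, hlast⟩ := hcon
  unfold BadLastRound at hlast
  push Not at hlast
  have hroot : update o I.root c I.root = c := update_self ..
  have hf := fun v => (AllAccept.fingerprint_eq h v).2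
  simp only [hroot] at hf
  have hr : ∀ v, (tablesOf (W c) v).r = sumChallenges c := by
    by_contra! hne
    obtain ⟨v, hv⟩ := hlast.1 hne
    exact hv (hf v)
  have hj : ∀ j, ∑ v, localCheck α κ H (I.localInput v) (tablesOf (W c) v) j = 0 := by
    by_contra! hne
    refine hlast.2 hne ?_
    rw [← sum_localComb]
    have := AllAccept.sum_eq h
    rw [Finset.sum_add_distrib, hroot] at this
    rw [← this]
    simp only [tablesOf]
    ring
  obtain ⟨i, hi⟩ := exists_bad_round_of_checks hα hn hcast hI (AllAccept.target_le h) hr hj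
  exact hsum i hi

variable [Fintype F] [DecidableEq F]

/-- The shared polynomial is sent at time `k + i`, and the right one depends on masks and challenges
from before. Both are thus fixed when the challenge `k + i` is drawn, and their difference has at
most `n * k` roots. -/
theorem prob_badSumRound (hα : Injective α) (I : Instance n)
    {W : (Fin (2 * k + 1) → Challenge α) → ℕ → Fin n → Msg k F}
    (hW : PublicCoin.NonAnticipating W) (i : Fin k) (c : Fin (2 * k + 1) → Challenge α) :
    prob (fun x => BadSumRound κ H I W i (update c ⟨k + i, by omega⟩ x)) ≤
      (n * k : ℕ) / Fintype.card (Challenge α) := by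
  set t : Fin (2 * k + 1) := ⟨k + i, by omega⟩
  set G := roundPoly α (entry F κ H I) (fun a b => ∑ v, (tablesOf (W c) v).N b a) i
    (sumChallenges c) with hG
  have hshared : ∀ x, sharedPoly (tablesOf (W (update c t x))) i =
      sharedPoly (tablesOf (W c)) i := by
    intro x
    simp only [sharedPoly, tablesOf, readTables, strategy_update hW c t x (le_refl (k + i.val))]
  have hG' : ∀ x, roundPoly α (entry F κ H I)
      (fun a b => ∑ v, (tablesOf (W (update c t x)) v).N b a) i
      (sumChallenges (update c t x)) = G := by
    intro x
    have : (fun a b : Fin k => ∑ v, (tablesOf (W (update c t x)) v).N b a) =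
        fun a b => ∑ v, (tablesOf (W c) v).N b a := by
      funext a b
      have hb : b.val ≤ t.val := by simp only [t]; omega
      simp only [tablesOf, readTables, strategy_update hW c t x hb]
    rw [this, hG]
    refine roundPoly_congr α _ _ i fun j hj => sumChallenges_update c t x j ?_
    simp only [t]
    omega
  by_cases hne : sharedPoly (tablesOf (W c)) i = G
  · have : ∀ x, ¬ BadSumRound κ H I W i (update c t x) := by
      rintro x ⟨h, -⟩
      exact h (by rw [hshared, hG', hne])
    simp only [prob, this, Finset.filter_false, Finset.card_empty]
    simp only [Nat.cast_zero, zero_div]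
    positivity
  · refine card_roots_le (sub_ne_zero.2 hne) ?_ _ fun x hx => ?_
    · refine (natDegree_sub_le _ _).trans (max_le (natDegree_coefPoly_le _) ?_)
      refine (roundPoly_spec _ _ _ _ hα).1.trans ?_
      rw [mul_comm n]
      exact Nat.mul_le_mul_right _ (Nat.sub_le _ _)
    · have h := hx.2
      simp only [hshared, hG'] at h
      have hc : sumChallenges (update c t x) i = x.1 := by
        simp [sumChallenges, t]
      rw [hc] at h
      rw [eval_sub, h, sub_self]

/-- All tables are complete at time `2 * k`, before the last challenge. When both a fingerprint and
the linear combination are at risk, the roots of the product of the two polynomials cover both, so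
the degrees add. -/
theorem prob_badLastRound (I : Instance n)
    {W : (Fin (2 * k + 1) → Challenge α) → ℕ → Fin n → Msg k F}
    (hW : PublicCoin.NonAnticipating W) (c : Fin (2 * k + 1) → Challenge α) :
    prob (fun x => BadLastRound κ H I W (update c ⟨2 * k, by omega⟩ x)) ≤
      (k + 1 + k * k + k : ℕ) / Fintype.card (Challenge α) := by
  set t : Fin (2 * k + 1) := ⟨2 * k, by omega⟩
  have hT : ∀ x, tablesOf (W (update c t x)) = tablesOf (W c) := by
    intro x
    have hw : ∀ s ≤ 2 * k, W (update c t x) s = W c s := fun s hs => strategy_update hW c t x hs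
    funext v
    simp only [tablesOf, readTables, Tables.mk.injEq]
    refine ⟨?_, ?_, ?_, ?_, ?_⟩ <;> funext i <;> rw [hw _ (by omega)]
  have hr : ∀ x, sumChallenges (update c t x) = sumChallenges c := by
    intro x
    funext i
    refine sumChallenges_update c t x i ?_
    simp only [t]
    omega
  have hl : ∀ x, lastChallenge (update c t x) = x.1 := by
    intro x
    simp [lastChallenge, t]
  have hz : ∀ x, W (update c t x) 0 = W c 0 := fun x => strategy_update hW c t x (Nat.zero_le _)
  simp only [BadLastRound, hT, hr, hl, hz]
  by_cases hv : ∃ v, (tablesOf (W c) v).r ≠ sumChallenges c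
  · obtain ⟨v, hv⟩ := hv
    obtain ⟨P, hP, hPd, hPe⟩ := fingerprint_poly hv
    by_cases hj : ∃ j, ∑ v, localCheck α κ H (I.localInput v) (tablesOf (W c) v) j ≠ 0
    · obtain ⟨P', hP', hPd', hPe'⟩ :=
        comb_poly hj (∑ v, (W c 0 v).2 1 - (W c 0 I.root).2 2)
      refine card_roots_le (mul_ne_zero hP' hP)
        (natDegree_mul_le.trans (add_le_add hPd' hPd)) _ fun x hx => ?_
      rw [eval_mul, hPe, hPe']
      rcases hx with hx | hx
      · rw [hx.2 v, sub_self, mul_zero]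
      · rw [hx.2, zero_mul]
    · refine card_roots_le hP (hPd.trans (Nat.le_add_left _ _)) _ fun x hx => ?_
      rw [hPe]
      rcases hx with hx | hx
      · rw [hx.2 v, sub_self]
      · exact absurd hx.1 hj
  · by_cases hj : ∃ j, ∑ v, localCheck α κ H (I.localInput v) (tablesOf (W c) v) j ≠ 0
    · obtain ⟨P', hP', hPd', hPe'⟩ :=
        comb_poly hj (∑ v, (W c 0 v).2 1 - (W c 0 I.root).2 2)
      refine card_roots_le hP' (hPd'.trans (Nat.le_add_right _ _)) _ fun x hx => ?_
      rw [hPe']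
      rcases hx with hx | hx
      · exact absurd hx.1 hv
      · exact hx.2
    · simp only [hv, hj, false_and, or_self, prob, Finset.filter_false, Finset.card_empty]
      simp only [Nat.cast_zero, zero_div]
      positivity

theorem protocol_sound [Nonempty (Challenge α)] (hα : Injective α) (hn : (n : F) ≠ 0)
    (hcast : ∀ a b : ℕ, a ≤ n ^ k → b ≤ n ^ k → (a : F) = b → a = b) {I : Instance n}
    (hI : numCopies κ H I.graph ≠ I.target) (o : Fin n → Fin (2 * k + 1) → Challenge α)
    (W : (Fin (2 * k + 1) → Challenge α) → ℕ → Fin n → Msg k F)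
    (hW : PublicCoin.NonAnticipating W) :
    prob (fun c => (protocol α κ H).AllAccept I (update o I.root c) (W c)) ≤
      (2 * k + 1 : ℕ) * ((n * k + (k + 1 + k * k + k) : ℕ) / Fintype.card (Challenge α)) := by
  have h := prob_exists_le_of_update
    (fun (t : Fin (2 * k + 1)) c => (∃ i : Fin k, t.val = k + i ∧ BadSumRound κ H I W i c) ∨
      (t.val = 2 * k ∧ BadLastRound κ H I W c))
    (δ := (n * k + (k + 1 + k * k + k) : ℕ) / Fintype.card (Challenge α)) ?_
  · rw [Fintype.card_fin] at h
    refine le_trans (prob_mono fun c hc => ?_) h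
    rcases AllAccept.bad hα hn hcast hI hc with ⟨i, hi⟩ | hl
    · exact ⟨⟨k + i, by omega⟩, Or.inl ⟨i, rfl, hi⟩⟩
    · exact ⟨⟨2 * k, by omega⟩, Or.inr ⟨rfl, hl⟩⟩
  · intro t c
    by_cases ht : ∃ i : Fin k, t.val = k + i
    · obtain ⟨i, hi⟩ := ht
      have hk : k + i.val < 2 * k + 1 := by omega
      obtain rfl : t = ⟨k + i, hk⟩ := Fin.ext hi
      refine le_trans (prob_mono fun x hx => ?_)
        ((prob_badSumRound (κ := κ) (H := H) hα I hW i c).trans ?_)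
      · rcases hx with ⟨j, hj, hx⟩ | ⟨h2, -⟩
        · obtain rfl : i = j := Fin.ext (by simp only at hj; omega)
          exact hx
        · simp only at h2
          omega
      · gcongr
        exact Nat.le_add_right _ _
    · by_cases ht2 : t.val = 2 * k
      · have hk : 2 * k < 2 * k + 1 := by omega
        obtain rfl : t = ⟨2 * k, hk⟩ := Fin.ext ht2
        refine le_trans (prob_mono fun x hx => ?_)
          ((prob_badLastRound (κ := κ) (H := H) I hW c).trans ?_)
        · rcases hx with ⟨j, hj, hx⟩ | ⟨h2, hx⟩
          · exact absurd ⟨j, hj⟩ ht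
          · exact hx
        · exact div_le_div_of_nonneg_right (Nat.cast_le.2 (Nat.le_add_left _ _))
            (Nat.cast_nonneg _)
      · have : ∀ x, ¬ ((∃ i : Fin k, t.val = k + i ∧ BadSumRound κ H I W i (update c t x)) ∨
            (t.val = 2 * k ∧ BadLastRound κ H I W (update c t x))) := by
          rintro x (⟨j, hj, -⟩ | ⟨h2, -⟩)
          · exact ht ⟨j, hj⟩
          · exact ht2 h2
        simp only [prob, this, Finset.filter_false, Finset.card_empty]
        simp only [Nat.cast_zero, zero_div]
        positivity

end Soundness

end DistZK

namespace DistZK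

/-! ### The honest prover -/

open Function Polynomial

section Tree

variable {F : Type} [Field F] {n : ℕ}

/-- The system is square, so it is enough that its transpose has trivial kernel. A kernel vector
vanishes at the root and is constant along parent pointers, which all lead to the root. -/
theorem exists_treeSum (I : Instance n) (c : Fin n → F) :
    ∃ s : Fin n → F, ∀ v, s v = c v + childSum I s v := by
  classical
  let A : Matrix (Fin n) (Fin n) F := fun v u =>
    (if u = v then 1 else 0) - if I.graph.Adj u v ∧ I.parent u = v then 1 else 0
  have hA : ∀ (s : Fin n → F) v, A.mulVec s v = s v - childSum I s v := by
    intro s v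
    simp [A, Matrix.mulVec, dotProduct, sub_mul, childSum]
  have hAt : ∀ (t : Fin n → F) u, Matrix.vecMul t A u =
      t u - if I.graph.Adj u (I.parent u) then t (I.parent u) else 0 := by
    intro t u
    simp only [A, Matrix.vecMul, dotProduct, mul_sub, Finset.sum_sub_distrib, mul_ite, mul_one,
      mul_zero, Finset.sum_ite_eq, Finset.mem_univ, if_true]
    congr 1
    rw [Finset.sum_eq_single (I.parent u)]
    · simp
    · intro v _ hv
      exact if_neg fun h => hv h.2.symm
    · simp
  have hinj : Injective fun t => Matrix.vecMul t A := by
    have h0 : ∀ t, Matrix.vecMul t A = 0 → t = 0 := by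
      intro t ht
      have hroot : t I.root = 0 := by
        have := congrFun ht I.root
        rw [hAt, I.parent_root _ rfl] at this
        simpa using this
      have hpar : ∀ u, u.val ≠ 0 → t u = t (I.parent u) := by
        intro u hu
        have := congrFun ht u
        rw [hAt, if_pos (I.parent_adj u hu)] at this
        exact sub_eq_zero.1 this
      have hit : ∀ m u, (I.parent^[m] u).val = 0 → t u = 0 := by
        intro m
        induction m with
        | zero =>
          intro u hu
          rw [(I.val_eq_zero_iff u).1 hu, hroot]
        | succ m ih =>
          intro u hu
          by_cases h : u.val = 0
          · rw [(I.val_eq_zero_iff u).1 h, hroot]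
          · rw [hpar u h]
            exact ih _ hu
      funext u
      obtain ⟨m, hm⟩ := I.parent_reaches_root u
      exact hit m u hm
    intro t t' h
    refine sub_eq_zero.1 (h0 _ ?_)
    rw [Matrix.sub_vecMul]
    exact sub_eq_zero.2 h
  have hsurj := Matrix.mulVec_surjective_iff_isUnit.2 (Matrix.vecMul_injective_iff_isUnit.1 hinj)
  obtain ⟨s, hs⟩ := hsurj c
  refine ⟨s, fun v => ?_⟩
  rw [← hs, hA]
  ring

/-- The sums of `c` over the subtrees of the nodes. -/
noncomputable def treeSum (I : Instance n) (c : Fin n → F) : Fin n → F :=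
  (exists_treeSum I c).choose

theorem treeSum_eq (I : Instance n) (c : Fin n → F) (v : Fin n) :
    treeSum I c v = c v + childSum I (treeSum I c) v :=
  (exists_treeSum I c).choose_spec v

theorem treeSum_root (I : Instance n) (c : Fin n → F) : treeSum I c I.root = ∑ v, c v := by
  have h := Finset.sum_congr rfl fun v (_ : v ∈ Finset.univ) => treeSum_eq I c v
  rw [Finset.sum_add_distrib, sum_childSum] at h
  linear_combination h

end Tree

/-! ### Scheduling of the honest prover's messages -/

section Rows

/-- The rows of a table, sent from the time `o` on. -/
def row {k : ℕ} {β : Type} [Zero β] (o : ℕ) (f : Fin k → β) (t : ℕ) : β :=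
  if h : o ≤ t ∧ t - o < k then f ⟨t - o, h.2⟩ else 0

theorem row_add {k : ℕ} {β : Type} [Zero β] (o : ℕ) (f : Fin k → β) (i : Fin k) :
    row o f (o + i) = f i := by
  have h : o ≤ o + i.val ∧ o + i.val - o < k := ⟨by omega, by omega⟩
  rw [row, dif_pos h]
  congr 1
  exact Fin.ext (by simp)

theorem row_congr {k : ℕ} {β : Type} [Zero β] {o : ℕ} {f g : Fin k → β} {t : ℕ}
    (h : ∀ i : Fin k, t = o + i → f i = g i) : row o f t = row o g t := by
  unfold row
  split_ifs with ht
  · exact h _ (by simp only; omega)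
  · rfl

end Rows

variable {F : Type} [Field F] {n k : ℕ} {α : Fin n → F}

/-- The challenge that precedes the time `t`. -/
def echo (c : Fin (2 * k + 1) → Challenge α) (t : ℕ) : F :=
  if h : 0 < t ∧ t - 1 < 2 * k + 1 then (c ⟨t - 1, h.2⟩).1 else 0

/-- The messages that transmit the given tables, challenges, masks and subtree sum. -/
def message (T : Tables k F) (c : Fin (2 * k + 1) → Challenge α) (z ζ s : F) (t : ℕ) : Msg k F :=
  (![row k T.X t, row k T.Y t, row 0 T.N t, row (k + 1) T.U t],
    ![echo c t, z, ζ, if t = 2 * k + 1 then s else 0])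

section Reading

variable {T : Tables k F} {c : Fin (2 * k + 1) → Challenge α} {z ζ s : F} {w : ℕ → Msg k F}

theorem readTables_eq (hr : T.r = sumChallenges c)
    (hw : ∀ t ≤ 2 * k + 1, w t = message T c z ζ s t) : readTables w = T := by
  have h0 : ∀ i : Fin k, i.val = 0 + i := by simp
  cases T
  simp only [readTables, Tables.mk.injEq]
  refine ⟨?_, ?_, ?_, ?_, ?_⟩ <;> funext i
  · rw [hw _ (by omega)]
    exact row_add _ _ i
  · rw [hw _ (by omega)]
    exact row_add _ _ i
  · rw [hw _ (by omega), h0 i]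
    exact row_add _ _ i
  · rw [hw _ (by omega)]
    exact row_add _ _ i
  · rw [hw _ (by omega)]
    simp only at hr
    subst hr
    have : 0 < k + i.val + 1 ∧ k + i.val + 1 - 1 < 2 * k + 1 := ⟨by omega, by omega⟩
    simp only [message, Matrix.cons_val_zero, echo, dif_pos this, sumChallenges]
    rfl

theorem read_last (hw : ∀ t ≤ 2 * k + 1, w t = message T c z ζ s t) :
    (w (2 * k + 1)).2 0 = lastChallenge c ∧ (w (2 * k + 1)).2 3 = s ∧
      (w 0).2 1 = z ∧ (w 0).2 2 = ζ := by
  rw [hw _ le_rfl, hw _ (Nat.zero_le _)]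
  refine ⟨?_, ?_, rfl, rfl⟩
  · simp [message, echo, lastChallenge]
  · simp [message]

end Reading

section Honest

variable (κ : CopyKind) (H : SimpleGraph (Fin k)) (I : Instance n)

/-- The masks, from their shares. -/
def masks (N : Fin n → Fin k → Fin k → F) (a b : Fin k) : F := ∑ v, N v b a

/-- The second shares of the coefficients of the sum-check polynomials. -/
noncomputable def honestY (X N : Fin n → Fin k → Fin k → F) (c : Fin (2 * k + 1) → Challenge α)
    (b : Fin n) (i j : Fin k) : F :=
  (roundPoly α (entry F κ H I) (masks N) i (sumChallenges c)).coeff (b.val + n * j.val) - X b i j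

/-- The masked entries. -/
noncomputable def honestU (N : Fin n → Fin k → Fin k → F) (c : Fin (2 * k + 1) → Challenge α)
    (b a : Fin k) : F :=
  if a < b then maskedEntry α (entry F κ H I a b) (masks N a b) (sumChallenges c a)
    (sumChallenges c b)
  -- The slots that no check reads carry the plain masks, so that the whole table `U` determines
  -- them and is uniform.
  else masks N a b

/-- The tables of the nodes with the honest prover. -/
noncomputable def honestTables (X N : Fin n → Fin k → Fin k → F)
    (c : Fin (2 * k + 1) → Challenge α) (v : Fin n) : Tables k F where
  X := X v
  Y := honestY κ H I X N c (finRotate n v)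
  N := N v
  U := honestU κ H I N c
  r := sumChallenges c

/-- The masked subtree sums. -/
noncomputable def honestSums (X N : Fin n → Fin k → Fin k → F) (z : Fin n → F)
    (c : Fin (2 * k + 1) → Challenge α) : Fin n → F :=
  treeSum I fun v => localComb α κ H (I.localInput v) (honestTables κ H I X N c v)
    (lastChallenge c) + z v

/-- The coins of the honest prover: shares of coefficients, shares of masks for the entries, and
masks for the final summation. -/
abbrev ProverCoin (n k : ℕ) (F : Type) : Type :=
  (Fin n → Fin k → Fin k → F) × (Fin n → Fin k → Fin k → F) × (Fin n → F)

/-- The strategy of the honest prover. -/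
noncomputable def honestStrategy (pc : ProverCoin n k F) (c : Fin (2 * k + 1) → Challenge α)
    (t : ℕ) (v : Fin n) : Msg k F :=
  message (honestTables κ H I pc.1 pc.2.1 c v) c (pc.2.2 v) (∑ u, pc.2.2 u)
    (honestSums κ H I pc.1 pc.2.1 pc.2.2 c v) t

theorem honestStrategy_nonAnticipating (pc : ProverCoin n k F) :
    PublicCoin.NonAnticipating (honestStrategy (α := α) κ H I pc) := by
  intro c c' t h
  have hs : ∀ i : Fin k, k + i.val < t → sumChallenges c i = sumChallenges c' i := by
    intro i hi
    unfold sumChallenges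
    rw [h _ hi]
  funext v
  have hX : row k (honestTables κ H I pc.1 pc.2.1 c v).Y t =
      row k (honestTables κ H I pc.1 pc.2.1 c' v).Y t := by
    refine row_congr fun i hi => ?_
    funext j
    simp only [honestTables, honestY]
    rw [roundPoly_congr α _ _ i fun j hj => hs j (by rw [hi]; exact Nat.add_lt_add_left hj k)]
  have hU : row (k + 1) (honestTables κ H I pc.1 pc.2.1 c v).U t =
      row (k + 1) (honestTables κ H I pc.1 pc.2.1 c' v).U t := by
    refine row_congr fun b hb => ?_
    funext a
    simp only [honestTables, honestU]
    split_ifs with hab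
    · have : a.val < b.val := hab
      rw [hs a (by omega), hs b (by omega)]
    · rfl
  have he : echo c t = echo c' t := by
    unfold echo
    split_ifs with ht
    · rw [h _ (by simp only; omega)]
    · rfl
  have hl : (if t = 2 * k + 1 then honestSums κ H I pc.1 pc.2.1 pc.2.2 c v else 0) =
      if t = 2 * k + 1 then honestSums κ H I pc.1 pc.2.1 pc.2.2 c' v else 0 := by
    split_ifs with ht
    · rw [show c = c' from funext fun j => h j (by omega)]
    · rfl
  simp only [honestStrategy, message, hX, hU, he, hl]
  rfl

variable {κ H I}

theorem honest_checks (hα : Injective α) (hn : (n : F) ≠ 0)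
    (hI : numCopies κ H I.graph = I.target) (X N : Fin n → Fin k → Fin k → F)
    (c : Fin (2 * k + 1) → Challenge α) (j : CheckIndex k) :
    ∑ v, localCheck α κ H (I.localInput v) (honestTables κ H I X N c v) j = 0 := by
  set T := honestTables κ H I X N c with hT
  set r := sumChallenges c with hr
  have hTr : ∀ v, (T v).r = r := fun _ => rfl
  have hshared : ∀ i, sharedPoly T i = roundPoly α (entry F κ H I) (masks N) i r := by
    intro i
    have hdeg : (roundPoly α (entry F κ H I) (masks N) i r).natDegree < k * n := by
      refine (roundPoly_spec _ _ _ _ hα).1.trans_lt ?_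
      exact Nat.mul_lt_mul_of_pos_right (by have := i.isLt; omega) I.pos
    rw [← coefPoly_coeff hdeg, sharedPoly]
    congr 1
    funext b j
    simp only [hT, honestTables, honestY, Equiv.apply_symm_apply]
    ring
  rcases j with i | ⟨a, b⟩
  · simp only [localCheck, Finset.sum_sub_distrib, sub_eq_zero]
    have hlhs : ∑ v, localLhs α (I.localInput v) (T v) i =
        partialSum α (pattern α (entry F κ H I) (masks N)) i r := by
      refine Fin.lastCases ?_ (fun i => ?_) i
      · rw [sum_localLhs_last, Fin.val_last, partialSum_top α hn, pattern]
        refine Finset.prod_congr rfl fun q hq => ?_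
        have hq' : q.1 < q.2 := by simpa [pairs] using hq
        simp [hT, honestTables, honestU, hq', hr]
      · rw [sum_localLhs_castSucc, hshared, sum_eval_roundPoly _ _ _ _ hα hn]
        rfl
    have hrhs : ∑ v, localRhs H (I.localInput v) (T v) i =
        partialSum α (pattern α (entry F κ H I) (masks N)) i r := by
      refine Fin.cases ?_ (fun i => ?_) i
      · rw [sum_localRhs_zero, ← hI]
        exact (partialSum_pattern_entry hα I _ r).symm
      · rw [sum_localRhs_succ H I T hTr, hshared, eval_roundPoly_self _ _ _ _ hα]
        rfl
    rw [hlhs, hrhs]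
  · simp only [localCheck]
    split_ifs with hab
    · rw [sum_localPairCheck α κ H I T hTr, sub_eq_zero]
      simp only [hT, honestTables, honestU, hab, if_true]
      rfl
    · simp

theorem honestSums_eq (X N : Fin n → Fin k → Fin k → F) (z : Fin n → F)
    (c : Fin (2 * k + 1) → Challenge α) (v : Fin n) :
    honestSums κ H I X N z c v =
      localComb α κ H (I.localInput v) (honestTables κ H I X N c v) (lastChallenge c) + z v +
        childSum I (honestSums κ H I X N z c) v :=
  treeSum_eq _ _ _

theorem honestSums_root (hα : Injective α) (hn : (n : F) ≠ 0)
    (hI : numCopies κ H I.graph = I.target) (X N : Fin n → Fin k → Fin k → F) (z : Fin n → F)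
    (c : Fin (2 * k + 1) → Challenge α) :
    honestSums κ H I X N z c I.root = ∑ v, z v := by
  rw [honestSums, treeSum_root, Finset.sum_add_distrib, sum_localComb]
  simp [honest_checks hα hn hI]

theorem protocol_complete (hα : Injective α) (hn : (n : F) ≠ 0)
    (hI : numCopies κ H I.graph = I.target) (pc : ProverCoin n k F)
    (coins : Fin n → Fin (2 * k + 1) → Challenge α) (w : ℕ → Fin n → Msg k F)
    (hw : ∀ t ≤ 2 * k + 1, ∀ v, w t v = honestStrategy κ H I pc (coins I.root) t v) :
    (protocol α κ H).AllAccept I coins w := by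
  have hT : ∀ v, (readTables fun t => w t v) =
      honestTables κ H I pc.1 pc.2.1 (coins I.root) v := fun v =>
    readTables_eq (c := coins I.root) rfl fun t ht => hw t ht v
  have hl := fun v => read_last (c := coins I.root) fun t ht => hw t ht v
  intro v
  refine ⟨?_, fun hv => ?_, fun u m hm => ?_, ?_⟩
  · change Nat.card (H ≃g H) * I.target ≤ n ^ k
    rw [← hI]
    exact card_mul_numCopies_le κ H I.graph
  · obtain rfl : v = I.root := (I.val_eq_zero_iff v).1 hv
    refine ⟨congrArg Tables.r (hT _), (hl _).1, ?_⟩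
    rw [(hl _).2.1, (hl _).2.2.2]
    exact honestSums_root hα hn hI _ _ _ _
  · classical
    by_cases huv : I.graph.Adj u v
    · simp only [PublicCoin.received, huv, if_true, Option.some.injEq] at hm
      subst hm
      simp only [protocol, hT, (hl _).1]
      exact ⟨trivial, rfl⟩
    · simp [PublicCoin.received, huv] at hm
  · rw [sum_received]
    simp only [hT, (hl _).1, (hl _).2.1, (hl _).2.2.1]
    exact honestSums_eq _ _ _ _ _

end Honest

end DistZK

namespace DistZK

/-! ### Zero knowledge -/

open Function Polynomial

variable {F : Type} [Field F] {n k : ℕ} {α : Fin n → F}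

/-- In the simulation the nodes tell their parents that they are their children. -/
noncomputable def simSend (li : LocalInput n) (u : Fin n) : EdgeMsg F :=
  open Classical in (0, 0, if li.parent = u then 1 else 0)

/-- The simulated tables of the node `v`, with independent entries. -/
def simTables (ω : (Fin n → Fin (2 * k + 1) → Challenge α) × ProverCoin n k F) (v root : Fin n) :
    Tables k F where
  X := ω.2.1 v
  Y := ω.2.1 (finRotate n v)
  N := ω.2.2.1 v
  U := ω.2.2.1 (finRotate n v)
  r := sumChallenges (ω.1 root)

/-- The simulated prover messages; the mask of the node is chosen to fit the simulated sums. -/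
noncomputable def simMsg (κ : CopyKind) (H : SimpleGraph (Fin k)) (li : LocalInput n)
    (inb : Fin n → Option (EdgeMsg F))
    (ω : (Fin n → Fin (2 * k + 1) → Challenge α) × ProverCoin n k F) : ℕ → Msg k F :=
  let root : Fin n := ⟨0, li.id.pos⟩
  message (simTables ω li.id root) (ω.1 root)
    (ω.2.2.2 li.id - ∑ u, ((inb u).elim 0 fun m => m.2.2 * ω.2.2.2 u) -
      localComb α κ H li (simTables ω li.id root) (lastChallenge (ω.1 root)))
    (ω.2.2.2 root) (ω.2.2.2 li.id)

/-- The simulated message from the neighbour `u`. -/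
noncomputable def simEdge (li : LocalInput n) (inb : Fin n → Option (EdgeMsg F))
    (ω : (Fin n → Fin (2 * k + 1) → Challenge α) × ProverCoin n k F) (u : Fin n) : EdgeMsg F :=
  let c := ω.1 ⟨0, li.id.pos⟩
  (lastChallenge c, fingerprint (sumChallenges c) (lastChallenge c),
    (inb u).elim 0 fun m => m.2.2 * ω.2.2.2 u)

/-- The change of variables that turns the coins of the prover into what the node `v` sees. -/
noncomputable def revealed (κ : CopyKind) (H : SimpleGraph (Fin k)) (I : Instance n) (v : Fin n)
    (ω : (Fin n → Fin (2 * k + 1) → Challenge α) × ProverCoin n k F) :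
    (Fin n → Fin (2 * k + 1) → Challenge α) × ProverCoin n k F :=
  (ω.1, update ω.2.1 (finRotate n v)
      (honestY κ H I ω.2.1 ω.2.2.1 (ω.1 I.root) (finRotate n v)),
    update ω.2.2.1 (finRotate n v) (honestU κ H I ω.2.2.1 (ω.1 I.root)),
    honestSums κ H I ω.2.1 ω.2.2.1 ω.2.2.2 (ω.1 I.root))

theorem eq_of_update_eq {ι β : Type} [DecidableEq ι] {f g : ι → β} {i : ι} {x y : β}
    (h : update f i x = update g i y) (hi : f i = g i) : f = g := by
  funext j
  by_cases hj : j = i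
  · rw [hj, hi]
  · simpa [hj] using congrFun h j

/-- The total and all shares but one determine the missing share. -/
theorem masks_injective {N N' : Fin n → Fin k → Fin k → F} (u : Fin n)
    (h : ∀ w, w ≠ u → N w = N' w) (hm : masks N = masks N') : N = N' := by
  funext w
  by_cases hw : w = u
  · subst hw
    funext b a
    have := congrFun (congrFun hm a) b
    simp only [masks] at this
    rw [← Finset.sum_erase_add _ _ (Finset.mem_univ w), ← Finset.sum_erase_add _ (fun v => N' v b a)
      (Finset.mem_univ w)] at this
    rw [Finset.sum_congr rfl fun v hv => by rw [h v (Finset.mem_erase.1 hv).1]] at this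
    exact add_left_cancel this
  · exact h w hw

/-- Challenges avoid the nodes, so the factor that multiplies a mask is nonzero and the masked entry
determines the mask. -/
theorem masks_eq_of_honestU {κ : CopyKind} {H : SimpleGraph (Fin k)} {I : Instance n}
    {N N' : Fin n → Fin k → Fin k → F} {c : Fin (2 * k + 1) → Challenge α}
    (h : honestU κ H I N c = honestU κ H I N' c) : masks N = masks N' := by
  funext a b
  have hab := congrFun (congrFun h b) a
  simp only [honestU] at hab
  split_ifs at hab with hlt
  · simp only [maskedEntry] at hab
    refine mul_right_cancel₀ (mul_ne_zero ?_ ?_) (add_left_cancel hab)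
    · exact eval_vanishing_ne_zero α (c _).2
    · exact eval_vanishing_ne_zero α (c _).2
  · exact hab

/-- The coins are recovered in order: `U` gives the total masks and so the overwritten share of `N`;
the round polynomials are then known and `Y` gives the overwritten share of `X`; finally each
subtree equation gives the mask of its node. -/
theorem revealed_injective (κ : CopyKind) (H : SimpleGraph (Fin k)) (I : Instance n) (v : Fin n) :
    Injective (revealed (α := α) (F := F) κ H I v) := by
  rintro ⟨o, X, N, z⟩ ⟨o', X', N', z'⟩ h
  simp only [revealed, Prod.mk.injEq] at h
  obtain ⟨rfl, hX, hN, hs⟩ := h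
  have hU : honestU κ H I N (o I.root) = honestU κ H I N' (o I.root) := by
    simpa using congrFun hN (finRotate n v)
  obtain rfl : N = N' := by
    refine masks_injective (finRotate n v) (fun w hw => ?_) (masks_eq_of_honestU hU)
    have := congrFun hN w
    rwa [update_of_ne hw, update_of_ne hw] at this
  obtain rfl : X = X' := by
    refine eq_of_update_eq hX ?_
    have hY := congrFun hX (finRotate n v)
    rw [update_self, update_self] at hY
    funext i j
    have := congrFun (congrFun hY i) j
    simp only [honestY] at this
    exact sub_right_injective this
  obtain rfl : z = z' := by
    funext u
    have h1 := honestSums_eq (κ := κ) (H := H) (I := I) X N z (o I.root) u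
    have h2 := honestSums_eq (κ := κ) (H := H) (I := I) X N z' (o I.root) u
    rw [hs, h2] at h1
    exact (add_left_cancel (add_right_cancel h1)).symm
  rfl

theorem simTables_revealed (κ : CopyKind) (H : SimpleGraph (Fin k)) (I : Instance n) (v : Fin n)
    (hv : finRotate n v ≠ v)
    (ω : (Fin n → Fin (2 * k + 1) → Challenge α) × ProverCoin n k F) :
    simTables (revealed κ H I v ω) v I.root =
      honestTables κ H I ω.2.1 ω.2.2.1 (ω.1 I.root) v := by
  simp only [simTables, revealed, honestTables, update_self, update_of_ne hv.symm]

/-- With a single node both shares of a coefficient would meet; this is where `2 ≤ n` enters. -/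
theorem finRotate_ne_self (hn : 2 ≤ n) (v : Fin n) : finRotate n v ≠ v := by
  obtain ⟨m, rfl⟩ : ∃ m, n = m + 2 := ⟨n - 2, by omega⟩
  rw [finRotate_apply]
  intro h
  have := add_left_cancel (h.trans (add_zero v).symm)
  exact one_ne_zero this

-- Under the bijection `revealed` the honest tables become independent coordinates of the sample.
-- The node's own mask is then forced by its subtree equation, and this is the value that the
-- simulator computes.
set_option synthInstance.maxSize 1000 in
theorem protocol_zeroKnowledge [Fintype F] [DecidableEq F] [Nonempty (Challenge α)] {l B : ℕ}
    (ℰ : Encodings l B (Challenge α) (Msg k F) (EdgeMsg F)) {κ : CopyKind}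
    {H : SimpleGraph (Fin k)} {I : Instance n} (hα : Injective α) (hn0 : (n : F) ≠ 0)
    (hn : 2 ≤ n) (hI : numCopies κ H I.graph = I.target) (v : Fin n) :
    tvDist ((PublicCoin.simulator (PC := ProverCoin n k F) (protocol α κ H) ℰ simSend (simMsg κ H)
        simEdge).out I v)
      (((protocol α κ H).verifier ℰ).view
        (PublicCoin.honest ℰ I.root (honestStrategy κ H I)) I v) = 0 := by
  classical
  have hrec : ∀ (s : Fin n → F) u, ((PublicCoin.simReceived I simSend v u).elim 0
      fun m : EdgeMsg F => m.2.2 * s u) =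
      if I.graph.Adj u v ∧ I.parent u = v then s u else 0 := by
    intro s u
    by_cases h : I.graph.Adj u v
    · by_cases h' : I.parent u = v <;>
        simp [PublicCoin.simReceived, h, h', simSend, Instance.localInput]
    · simp [PublicCoin.simReceived, h]
  have hne := finRotate_ne_self hn v
  refine PublicCoin.tvDist_view_eq_zero _ ℰ I I.root _ _ _ _
    (honestStrategy_nonAnticipating κ H I) v (revealed κ H I v)
    (Finite.injective_iff_bijective.1 (revealed_injective κ H I v)) (fun _ => rfl)
    (fun ω t _ => ?_) (fun ω w hw u hu => ?_)
  · have hroot : (⟨0, (I.localInput v).id.pos⟩ : Fin n) = I.root := rfl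
    have hid : (I.localInput v).id = v := rfl
    simp only [simMsg, hroot, hid, simTables_revealed κ H I v hne, hrec]
    unfold honestStrategy
    simp only [revealed]
    have h1 := honestSums_eq (κ := κ) (H := H) (I := I) ω.2.1 ω.2.2.1 ω.2.2.2 (ω.1 I.root) v
    have h2 := honestSums_root hα hn0 hI ω.2.1 ω.2.2.1 ω.2.2.2 (ω.1 I.root)
    rw [h2]
    congr 1
    simp only [childSum] at h1
    linear_combination -h1
  · have hT : (readTables fun t => w t u) =
        honestTables κ H I ω.2.1 ω.2.2.1 (ω.1 I.root) u :=
      readTables_eq (c := ω.1 I.root) rfl fun t ht => hw t ht u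
    have hl := read_last (c := ω.1 I.root) fun t ht => hw t ht u
    simp only [protocol, simEdge, hT, hl.1, hl.2.1, hrec, hu, true_and]
    rfl

end DistZK

namespace DistZK

/-! ### Choice of the parameters -/

open Function

theorem exists_embedding_bits {β : Type} [Fintype β] {b : ℕ} (h : Fintype.card β ≤ 2 ^ b) :
    Nonempty (β ↪ Bits b) :=
  Function.Embedding.nonempty_of_card_le (by simpa using h)

/-- The number of bits of a field element. -/
def fieldBits (n k : ℕ) : ℕ := 8 + 2 * k + k * Nat.clog 2 (n + 2)

/-- Bertrand's postulate yields a prime large enough for soundness and for the range of the count,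
yet of `O(k log n)` bits. It is chosen independently of `q`. -/
theorem exists_prime_field (n k : ℕ) (hk : 2 ≤ k) :
    ∃ p : ℕ, p.Prime ∧ 100 * k ^ 2 * (n + 2) ^ k < p ∧ p ≤ 2 ^ fieldBits n k := by
  obtain ⟨p, hp, h1, h2⟩ := Nat.exists_prime_lt_and_le_two_mul (100 * k ^ 2 * (n + 2) ^ k)
    (by positivity)
  refine ⟨p, hp, h1, h2.trans ?_⟩
  have hk' : k ≤ 2 ^ k := Nat.lt_two_pow_self.le
  have hn : n + 2 ≤ 2 ^ Nat.clog 2 (n + 2) := Nat.le_pow_clog (by norm_num) _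
  calc 2 * (100 * k ^ 2 * (n + 2) ^ k) = 200 * k ^ 2 * (n + 2) ^ k := by ring
    _ ≤ 2 ^ 8 * (2 ^ k) ^ 2 * (2 ^ Nat.clog 2 (n + 2)) ^ k := by gcongr; norm_num
    _ = 2 ^ fieldBits n k := by
      rw [fieldBits, pow_add, pow_add, ← pow_mul, ← pow_mul, mul_comm k 2,
        mul_comm (Nat.clog 2 (n + 2)) k]

/-- The factor `3` is for soundness error `1/3`; the summand `n` pays for the field elements at the
nodes, which are not allowed as challenges. -/
theorem soundness_parameters (n k : ℕ) (hk : 2 ≤ k) :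
    3 * ((2 * k + 1) * (n * k + (k + 1 + k * k + k))) + n ≤ 100 * k ^ 2 * (n + 2) ^ k := by
  set A := (n + 2) ^ k with hA
  have h1 : n + 2 ≤ A := Nat.le_self_pow (by omega) _
  have h2 : k + 1 ≤ A := by
    have h3 : 2 ^ k ≤ A := Nat.pow_le_pow_left (by omega) k
    have h4 : k < 2 ^ k := Nat.lt_two_pow_self
    omega
  have h3 : 2 * k + 1 ≤ 3 * k := by omega
  have h4 : k + 1 + k * k + k ≤ 2 * k * (k + 1) := by nlinarith
  have h5 : 1 ≤ k ^ 2 := Nat.one_le_pow _ _ (by omega)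
  calc 3 * ((2 * k + 1) * (n * k + (k + 1 + k * k + k))) + n
      ≤ 3 * (3 * k * (A * k + 2 * k * A)) + k ^ 2 * A := by
        refine add_le_add (Nat.mul_le_mul_left _ (Nat.mul_le_mul h3 (add_le_add ?_ ?_))) ?_
        · exact Nat.mul_le_mul_right _ (by omega)
        · exact h4.trans (Nat.mul_le_mul_left _ h2)
        · nlinarith
    _ = 28 * k ^ 2 * A := by ring
    _ ≤ 100 * k ^ 2 * A := by gcongr; norm_num

theorem card_challenge_ge {F : Type} [Fintype F] [DecidableEq F] {n : ℕ} (α : Fin n → F) :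
    Fintype.card F ≤ Fintype.card (Challenge α) + n := by
  change _ ≤ Fintype.card {x : F // ∀ v, x ≠ α v} + n
  have h1 : Fintype.card {x : F // ¬ ∀ v, x ≠ α v} ≤ n := by
    rw [Fintype.card_subtype]
    refine (Finset.card_le_card (t := Finset.univ.image α) ?_).trans
      (Finset.card_image_le.trans (by simp))
    intro x hx
    simpa [eq_comm] using hx
  have h2 := Fintype.card_subtype_compl fun x : F => ∀ v, x ≠ α v
  have h3 := Fintype.card_subtype_le fun x : F => ∀ v, x ≠ α v
  omega

set_option synthInstance.maxSize 1000 in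
theorem exists_proof_system (κ : CopyKind) (n k : ℕ) (hk : 2 ≤ k) (H : SimpleGraph (Fin k)) :
    ∃ (V : Verifier n (2 * (2 * k + 1) + 1) ((4 * k + 4) * fieldBits n k) 1 (3 * fieldBits n k))
      (P : Instance n → Prover n ((4 * k + 4) * fieldBits n k))
      (S : Simulator n 1 (3 * fieldBits n k)
        (View n ((4 * k + 4) * fieldBits n k) (3 * fieldBits n k) V.Coin)),
      (∀ I : Instance n, numCopies κ H I.graph = I.target → 2 / 3 ≤ V.acceptProb (P I) I) ∧
      (∀ I : Instance n, numCopies κ H I.graph ≠ I.target → ∀ P', V.acceptProb P' I ≤ 1 / 3) ∧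
      (2 ≤ n → ∀ I : Instance n, numCopies κ H I.graph = I.target → ∀ v : Fin n,
        tvDist (S.out I v) (V.view (P I) I v) = 0) := by
  obtain ⟨p, hp, hp1, hp2⟩ := exists_prime_field n k hk
  have : Fact p.Prime := ⟨hp⟩
  have hparam := soundness_parameters n k hk
  have hnk : n ^ k < p := by
    refine lt_of_le_of_lt ?_ hp1
    calc n ^ k ≤ (n + 2) ^ k := Nat.pow_le_pow_left (by omega) k
      _ ≤ 100 * k ^ 2 * (n + 2) ^ k := Nat.le_mul_of_pos_left _ (by positivity)
  have hcastlt : ∀ a b : ℕ, a < p → b < p → (a : ZMod p) = b → a = b := by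
    intro a b ha hb h
    rw [ZMod.natCast_eq_natCast_iff'] at h
    rwa [Nat.mod_eq_of_lt ha, Nat.mod_eq_of_lt hb] at h
  have hcast : ∀ a b : ℕ, a ≤ n ^ k → b ≤ n ^ k → (a : ZMod p) = b → a = b :=
    fun a b ha hb => hcastlt a b (by omega) (by omega)
  let α : Fin n → ZMod p := fun v => (v.val : ZMod p)
  have hα : Injective α := fun u v h => Fin.ext (hcastlt _ _ (by omega) (by omega) h)
  have hn0 : ∀ I : Instance n, (n : ZMod p) ≠ 0 := by
    intro I h
    have := hcastlt n 0 (by omega) hp.pos (by simpa using h)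
    have := I.pos
    omega
  have hcard := card_challenge_ge α
  rw [ZMod.card] at hcard
  have hcpos : 0 < Fintype.card (Challenge α) := by omega
  have : Nonempty (Challenge α) := Fintype.card_pos_iff.1 hcpos
  -- A message has four rows of length `k` and four scalars, hence `4 * k + 4` field elements.
  have hmsg : Fintype.card (Msg k (ZMod p)) ≤ 2 ^ ((4 * k + 4) * fieldBits n k) := by
    simp only [Fintype.card_prod, Fintype.card_fun, Fintype.card_fin, ZMod.card]
    calc (p ^ k) ^ 4 * p ^ 4 = p ^ (4 * k + 4) := by ring
      _ ≤ (2 ^ fieldBits n k) ^ (4 * k + 4) := Nat.pow_le_pow_left hp2 _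
      _ = _ := by rw [← pow_mul, mul_comm]
  have hchal : Fintype.card (Challenge α) ≤ 2 ^ ((4 * k + 4) * fieldBits n k) := by
    refine (Fintype.card_subtype_le _).trans ?_
    rw [ZMod.card]
    exact hp2.trans (Nat.pow_le_pow_right (by norm_num) (Nat.le_mul_of_pos_left _ (by omega)))
  have hedge : Fintype.card (EdgeMsg (ZMod p)) ≤ 2 ^ (3 * fieldBits n k) := by
    simp only [Fintype.card_prod, ZMod.card]
    calc p * (p * p) = p ^ 3 := by ring
      _ ≤ (2 ^ fieldBits n k) ^ 3 := Nat.pow_le_pow_left hp2 _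
      _ = _ := by rw [← pow_mul, mul_comm]
  obtain ⟨e₁⟩ := exists_embedding_bits hchal
  obtain ⟨e₂⟩ := exists_embedding_bits hmsg
  obtain ⟨e₃⟩ := exists_embedding_bits hedge
  let ℰ : Encodings ((4 * k + 4) * fieldBits n k) (3 * fieldBits n k) (Challenge α)
    (Msg k (ZMod p)) (EdgeMsg (ZMod p)) := ⟨e₁, e₂, e₃⟩
  refine ⟨(protocol α κ H).verifier ℰ,
    fun I => PublicCoin.honest ℰ I.root (honestStrategy κ H I),
    PublicCoin.simulator (PC := ProverCoin n k (ZMod p)) (protocol α κ H) ℰ simSend (simMsg κ H)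
      simEdge, fun I hI => ?_, fun I hI P' => ?_, fun hn I hI v => ?_⟩
  · rw [PublicCoin.acceptProb_honest _ ℰ I I.root _ (honestStrategy_nonAnticipating κ H I)
      (protocol_complete hα (hn0 I) hI)]
    norm_num
  · refine PublicCoin.acceptProb_le _ ℰ I I.root (fun o W hW =>
      (protocol_sound hα (hn0 I) hcast hI o W hW).trans ?_) P'
    have hc : (0 : ℝ) < Fintype.card (Challenge α) := by exact_mod_cast hcpos
    rw [← mul_div_assoc, div_le_iff₀ hc]
    have h3 : 3 * ((2 * k + 1) * (n * k + (k + 1 + k * k + k))) ≤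
        Fintype.card (Challenge α) := by omega
    have h3' : (3 : ℝ) * ((2 * k + 1 : ℕ) * (n * k + (k + 1 + k * k + k) : ℕ)) ≤
        Fintype.card (Challenge α) := by exact_mod_cast h3
    linarith
  · exact protocol_zeroKnowledge ℰ hα (hn0 I) hn hI v

theorem fieldBits_le {n k : ℕ} (hn : 3 ≤ n) (hk : 2 ≤ k) :
    (fieldBits n k : ℝ) ≤ 10 * (k * Real.log n) := by
  have hn' : (3 : ℝ) ≤ n := by exact_mod_cast hn
  have hk' : (2 : ℝ) ≤ k := by exact_mod_cast hk
  have hlog : 1 ≤ Real.log n := by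
    rw [Real.le_log_iff_exp_le (by linarith)]
    linarith [Real.exp_one_lt_d9]
  have hclog : (Nat.clog 2 (n + 2) : ℝ) ≤ 1 + 3 * Real.log n := by
    have h1 : 2 ^ (Nat.clog 2 (n + 2)).pred < n + 2 :=
      Nat.pow_pred_clog_lt_self (by norm_num) (by omega)
    have h2 : (2 : ℝ) ^ (Nat.clog 2 (n + 2)).pred ≤ n ^ 2 := by
      have : (2 : ℝ) ^ (Nat.clog 2 (n + 2)).pred ≤ n + 2 := by exact_mod_cast h1.le
      nlinarith
    have h3 := Real.log_le_log (by positivity) h2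
    rw [Real.log_pow, Real.log_pow] at h3
    have h4 : (Nat.clog 2 (n + 2) : ℝ) ≤ (Nat.clog 2 (n + 2)).pred + 1 := by
      have : Nat.clog 2 (n + 2) ≤ (Nat.clog 2 (n + 2)).pred + 1 := by
        rw [Nat.pred_eq_sub_one]
        omega
      exact_mod_cast this
    have h5 := Real.log_two_gt_d9
    have h6 : (0 : ℝ) ≤ (Nat.clog 2 (n + 2)).pred := Nat.cast_nonneg _
    push_cast at h3
    nlinarith
  have : (fieldBits n k : ℝ) = 8 + 2 * k + k * Nat.clog 2 (n + 2) := by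
    simp [fieldBits]
  rw [this]
  nlinarith

end DistZK

/-! ### The asymptotic bounds -/

open DistZK Filter in
theorem theorem4 :
    ∃ C T c : ℕ, ∀ (κ : CopyKind) (k : ℕ → ℕ) (H : ∀ n, SimpleGraph (Fin (k n))) (q : ℕ → ℕ),
      (∀ n, 2 ≤ k n) → (∀ n, (q n).Prime) →
      (((∃ K : ℕ, ∀ n, k n ≤ K) ∧ ∀ e : ℕ, ∀ᶠ n in atTop, n ^ e < q n) ∨
        (Tendsto k atTop atTop ∧ ∀ᶠ n in atTop, n ^ k n < q n)) →
      ∃ r l B : ℕ → ℕ,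
        subgraphCounting κ k H ∈ DStatZK r l T B ∧
        (∀ᶠ n : ℕ in atTop,
          (r n : ℝ) ≤ C * (k n * Real.log (k n) + Real.log (Real.log n))) ∧
        (∀ᶠ n : ℕ in atTop,
          (l n : ℝ) ≤ C * (Real.log (q n) ^ 2 / Real.log (k n)
            + k n * Real.log (k n) * Real.log (q n))) ∧
        (∀ᶠ n : ℕ in atTop,
          (B n : ℝ) ≤ C * (k n * (Real.log n + Real.log (k n)) ^ c)) ∧
        ((∃ K : ℕ, ∀ n, k n ≤ K) →
          ∃ C' : ℝ, ∀ᶠ n : ℕ in atTop, (r n : ℝ) ≤ C' * Real.log (Real.log n)) := by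
  refine ⟨100, 1, 1, fun κ k H q hk hq hkq => ?_⟩
  -- Either alternative gives `n ^ k < q`, so `k log n ≤ log q`, which charges the field size to
  -- `q`.
  have hqk : ∀ᶠ n in atTop, n ^ k n < q n := by
    rcases hkq with ⟨⟨K, hK⟩, h⟩ | ⟨-, h⟩
    · filter_upwards [h K, eventually_ge_atTop 1] with n hn hn1
      exact (Nat.pow_le_pow_right hn1 (hK n)).trans_lt hn
    · exact h
  have hk2 : ∀ n, (2 : ℝ) ≤ k n := fun n => by exact_mod_cast hk n
  have hlogk : ∀ n, 0.69 ≤ Real.log (k n) := fun n =>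
    (by linarith [Real.log_two_gt_d9] : (0.69 : ℝ) ≤ Real.log 2).trans
      (Real.log_le_log (by norm_num) (hk2 n))
  have hlogn : ∀ n : ℕ, 3 ≤ n → 1 ≤ Real.log n := by
    intro n hn
    have hn' : (3 : ℝ) ≤ n := by exact_mod_cast hn
    rw [Real.le_log_iff_exp_le (by linarith)]
    linarith [Real.exp_one_lt_d9]
  choose V P S hcomplete hsound hzk using fun n => exists_proof_system κ n (k n) (hk n) (H n)
  refine ⟨fun n => 2 * (2 * k n + 1) + 1, fun n => (4 * k n + 4) * fieldBits n (k n),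
    fun n => 3 * fieldBits n (k n), ⟨V, P, S, hcomplete, hsound, fun c => ?_⟩, ?_, ?_, ?_, ?_⟩
  · filter_upwards [eventually_ge_atTop 2] with n hn I hI v
    rw [hzk n hn I hI v]
    positivity
  · filter_upwards [eventually_ge_atTop 3] with n hn
    have h1 := Real.log_nonneg (hlogn n hn)
    have h2 := mul_le_mul_of_nonneg_left (hlogk n) (by linarith [hk2 n] : (0 : ℝ) ≤ k n)
    push_cast
    linarith [hk2 n]
  · filter_upwards [eventually_ge_atTop 3, hqk] with n hn hq'
    have hn1 := hlogn n hn
    have hbits := fieldBits_le hn (hk n)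
    have hpos : (0 : ℝ) < (n : ℝ) ^ k n := by positivity
    have hlogq : k n * Real.log n ≤ Real.log (q n) := by
      rw [← Real.log_pow]
      exact Real.log_le_log hpos (by exact_mod_cast hq'.le)
    have hk0 : (0 : ℝ) < k n := by linarith [hk2 n]
    have hkn : (0 : ℝ) ≤ k n * Real.log n := by positivity
    have hsq : 0 ≤ Real.log (q n) ^ 2 / Real.log (k n) :=
      div_nonneg (sq_nonneg _) (by linarith [hlogk n])
    have h1 : (4 * k n + 4 : ℝ) * fieldBits n (k n) ≤ 6 * k n * (10 * (k n * Real.log n)) :=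
      mul_le_mul (by linarith [hk2 n]) hbits (Nat.cast_nonneg _) (by positivity)
    have h2 : k n * 0.69 * (k n * Real.log n) ≤ k n * Real.log (k n) * Real.log (q n) :=
      mul_le_mul (mul_le_mul_of_nonneg_left (hlogk n) hk0.le) hlogq hkn
        (mul_nonneg hk0.le (by linarith [hlogk n]))
    have h3 : 0 ≤ (k n : ℝ) * (k n * Real.log n) := by positivity
    push_cast
    -- The first summand of the bound is dropped as nonnegative; the second suffices because `6 * 10
    -- ≤ 100 * 0.69`.
    linarith
  · filter_upwards [eventually_ge_atTop 3] with n hn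
    have hbits := fieldBits_le hn (hk n)
    have hk0 : (0 : ℝ) < k n := by linarith [hk2 n]
    have h1 : 0 ≤ (k n : ℝ) * Real.log (k n) := mul_nonneg hk0.le (by linarith [hlogk n])
    have h2 : 0 ≤ (k n : ℝ) * Real.log n := mul_nonneg hk0.le (by linarith [hlogn n hn])
    push_cast
    rw [pow_one, mul_add]
    linarith
  · rintro ⟨K, hK⟩
    -- For bounded `k` the number of rounds is bounded, so `log log n` eventually exceeds it.
    refine ⟨1, ?_⟩
    have hlim : Tendsto (fun n : ℕ => Real.log (Real.log n)) atTop atTop :=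
      Real.tendsto_log_atTop.comp (Real.tendsto_log_atTop.comp tendsto_natCast_atTop_atTop)
    filter_upwards [hlim.eventually_ge_atTop ((2 * (2 * K + 1) + 1 : ℕ) : ℝ)] with n hn
    rw [one_mul]
    refine le_trans (Nat.cast_le.2 ?_) hn
    have := hK n
    omega
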